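/- **Theorem.** Let $R$ be an associative ring with identity. By an $R$-module we mean a left $R$-module; right $R$-modules are modules over the opposite ring $R^{\circ}$. We use the following notions. - A module $F$ over a ring is of *type $FP_\infty$* if it has a projective resolution by finitely generated projective modules. An $R$-module $A$ is *absolutely clean* if $\operatorname{Ext}^1_R(F,A)=0$ for every $R$-module $F$ of type $FP_\infty$. An $R$-module $L$ is *level* if $\operatorname{Tor}_1^R(F,L)=0$ for every right $R$-module $F$ of type $FP_\infty$. - An $R$-module $M$ is *Gorenstein projective* (resp. *Gorenstein AC-projective*) if there is an exact sequence $\cdots\to P_1\to P_0\to P_{-1}\to\cdots$ of projective $R$-modules with $M\cong\operatorname{Coker}(P_1\to P_0)$ that remains exact after applying $\operatorname{Hom}_R(-,L)$ for every projective (resp. level) $R$-module $L$. It is *Gorenstein AC-injective* if there is an exact sequence $\cdots\to I_1\to I_0\to I_{-1}\to\cdots$ of injective $R$-modules with $M\cong\operatorname{Coker}(I_1\to I_0)$ that remains exact after applying $\operatorname{Hom}_R(A,-)$ for every absolutely clean $R$-module $A$. - The *Gorenstein projective* (resp. *Gorenstein AC-projective*) *dimension* of $M$ is the least $n\ge 0$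 for which there is an exact sequence $0\to G_n\to\cdots\to G_0\to M\to 0$ with every $G_i$ Gorenstein projective (resp. Gorenstein AC-projective), and $\infty$ if there is none. The *Gorenstein AC-injective dimension* of $M$ is the least $n\ge 0$ for which there is an exact sequence $0\to M\to G^0\to\cdots\to G^n\to 0$ with every $G^i$ Gorenstein AC-injective, and $\infty$ if there is none. - The *global Gorenstein dimension*, the *global Gorenstein AC-projective dimension* and the *global Gorenstein AC-injective dimension* of $R$ are the suprema, over all $R$-modules $M$, of the Gorenstein projective, the Gorenstein AC-projective and the Gorenstein AC-injective dimension of $M$, respectively. - $R$ is *left* (resp. *right*) *coherent* if every finitely generated left (resp. right) ideal of $R$ is finitely presented. Suppose that the global Gorenstein dimension of $R$ is finite. Then: (a) if $R$ is left coherent, the global Gorenstein AC-injective dimension of $R$ is finite; (b) if $R$ is right coherent, the global Gorenstein AC-projective dimension of $R$ is finite. -/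

import Mathlib

open CategoryTheory CategoryTheory.Limits TensorProduct

universe u

noncomputable section

namespace GorAC

/-! Throughout, `R` is an associative ring with unit, not necessarily commutative.
An `R`-module is a left `R`-module, and a right `R`-module is a (left) module over the opposite
ring `Rᵐᵒᵖ`, so that `m * r` is `MulOpposite.op r • m`. -/

/-! ### Coherence -/

/-- `R` is left coherent: every finitely generated left ideal is finitely presented. -/
def IsLeftCoherent (R : Type u) [Ring R] : Prop :=
  ∀ I : Submodule R R, I.FG → Module.FinitePresentation R I

/-- `R` is right coherent: every finitely generated right ideal is finitely presented. -/
def IsRightCoherent (R : Type u) [Ring R] : Prop :=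
  ∀ I : Submodule Rᵐᵒᵖ R, I.FG → Module.FinitePresentation Rᵐᵒᵖ I

/-! ### The tensor product over a noncommutative ring, and `Tor` -/

section Tensor

variable (R : Type u) [Ring R]

/-- The relations `(m r) ⊗ l = m ⊗ (r l)` that define `M ⊗_R L` as a quotient of `M ⊗_ℤ L`. -/
def balancedRelations (M L : Type u) [AddCommGroup M] [Module Rᵐᵒᵖ M] [AddCommGroup L]
    [Module R L] : AddSubgroup (M ⊗[ℤ] L) :=
  AddSubgroup.closure
    {t | ∃ (m : M) (r : R) (l : L), t = (MulOpposite.op r • m) ⊗ₜ[ℤ] l - m ⊗ₜ[ℤ] (r • l)}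

/-- The abelian group `M ⊗_R L`, for a right `R`-module `M` and a left `R`-module `L`. -/
abbrev BalancedTensor (M L : Type u) [AddCommGroup M] [Module Rᵐᵒᵖ M] [AddCommGroup L]
    [Module R L] : Type u :=
  (M ⊗[ℤ] L) ⧸ balancedRelations R M L

/-- The homomorphism `f ⊗_R L : M ⊗_R L → N ⊗_R L` induced by `f : M → N`. -/
def balancedMap {M N : Type u} (L : Type u) [AddCommGroup M] [Module Rᵐᵒᵖ M] [AddCommGroup N]
    [Module Rᵐᵒᵖ N] [AddCommGroup L] [Module R L] (f : M →ₗ[Rᵐᵒᵖ] N) :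
    BalancedTensor R M L →+ BalancedTensor R N L :=
  QuotientAddGroup.map _ _
    (LinearMap.rTensor L f.toAddMonoidHom.toIntLinearMap).toAddMonoidHom (by
      refine (AddSubgroup.closure_le _).2 ?_
      rintro _ ⟨m, r, l, rfl⟩
      refine AddSubgroup.subset_closure ⟨f m, r, l, ?_⟩
      simp)

/-- Two homomorphisms out of `M ⊗_R L` that agree on all `m ⊗ l` are equal. -/
theorem balancedTensor_hom_ext {M L A : Type u} [AddCommGroup M] [Module Rᵐᵒᵖ M] [AddCommGroup L]
    [Module R L] [AddCommGroup A] {f g : BalancedTensor R M L →+ A}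
    (h : ∀ (m : M) (l : L), f (QuotientAddGroup.mk (m ⊗ₜ[ℤ] l)) =
      g (QuotientAddGroup.mk (m ⊗ₜ[ℤ] l))) : f = g := by
  refine QuotientAddGroup.addMonoidHom_ext _ (AddMonoidHom.ext fun x => ?_)
  induction x using TensorProduct.induction_on with
  | zero => rw [map_zero, map_zero]
  | tmul m l => exact h m l
  | add x y hx hy => rw [map_add, map_add, hx, hy]

/-- The functor `- ⊗_R L` from right `R`-modules to abelian groups. -/
def tensorFunctor (L : ModuleCat.{u} R) : ModuleCat.{u} Rᵐᵒᵖ ⥤ AddCommGrpCat.{u} where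
  obj M := AddCommGrpCat.of (BalancedTensor R M L)
  map f := AddCommGrpCat.ofHom (balancedMap R L f.hom)
  map_id M := by
    ext : 1
    exact balancedTensor_hom_ext R fun m l => rfl
  map_comp f g := by
    ext : 1
    exact balancedTensor_hom_ext R fun m l => rfl

instance (L : ModuleCat.{u} R) : (tensorFunctor R L).Additive where
  map_add {M N f g} := by
    ext : 1
    exact balancedTensor_hom_ext R fun m l =>
      congrArg (QuotientAddGroup.mk' (balancedRelations R N L))
        (TensorProduct.add_tmul (f.hom m) (g.hom m) l)

/-- `Tor_n^R(F, L)`, for a right `R`-module `F` and a left `R`-module `L`. -/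
def Tor (n : ℕ) (F : ModuleCat.{u} Rᵐᵒᵖ) (L : ModuleCat.{u} R) : AddCommGrpCat.{u} :=
  ((tensorFunctor R L).leftDerived n).obj F

end Tensor

/-! ### Modules of type `FP_∞`, absolutely clean modules, level modules -/

section Modules

variable {R : Type u} [Ring R]

/-- `F` is of type `FP_∞`: it has a projective resolution by finitely generated modules. -/
def IsTypeFPInfty (F : ModuleCat.{u} R) : Prop :=
  ∃ P : ProjectiveResolution F, ∀ n, Module.Finite R (P.complex.X n)

/-- `A` is absolutely clean: `Ext¹_R(F, A) = 0` for all `F` of type `FP_∞`. -/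
def IsAbsolutelyClean (A : ModuleCat.{u} R) : Prop :=
  ∀ F : ModuleCat.{u} R, IsTypeFPInfty F → Subsingleton (Abelian.Ext F A 1)

/-- A left `R`-module `L` is level: `Tor_1^R(F, L) = 0` for all right `R`-modules `F` of
type `FP_∞`. -/
def IsLevel (L : ModuleCat.{u} R) : Prop :=
  ∀ F : ModuleCat.{u} Rᵐᵒᵖ, IsTypeFPInfty F → IsZero (Tor R 1 F L)

/-! ### Gorenstein (AC-)projective and Gorenstein (AC-)injective modules -/

/-- The complex of abelian groups `Hom_R(P, L)` is exact. -/
def HomExactInto (P : ChainComplex (ModuleCat.{u} R) ℤ) (L : ModuleCat.{u} R) : Prop :=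
  ∀ i : ℤ, Function.Exact (fun g : P.X i ⟶ L => P.d (i + 1) i ≫ g)
    (fun f : P.X (i + 1) ⟶ L => P.d (i + 1 + 1) (i + 1) ≫ f)

/-- The complex of abelian groups `Hom_R(A, I)` is exact. -/
def HomExactFrom (A : ModuleCat.{u} R) (I : ChainComplex (ModuleCat.{u} R) ℤ) : Prop :=
  ∀ i : ℤ, Function.Exact (fun g : A ⟶ I.X (i + 1 + 1) => g ≫ I.d (i + 1 + 1) (i + 1))
    (fun f : A ⟶ I.X (i + 1) => f ≫ I.d (i + 1) i)

/-- `M` is the cokernel of `P_1 → P_0` for an exact complex `P` of projective modules such that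
`Hom_R(P, L)` is exact for all `L` in the class `𝓛`. -/
def IsGProjectiveRel (𝓛 : ModuleCat.{u} R → Prop) (M : ModuleCat.{u} R) : Prop :=
  ∃ P : ChainComplex (ModuleCat.{u} R) ℤ,
    (∀ i, Projective (P.X i)) ∧ P.Acyclic ∧ Nonempty (M ≅ cokernel (P.d 1 0)) ∧
      ∀ L, 𝓛 L → HomExactInto P L

/-- `M` is the cokernel of `I_1 → I_0` for an exact complex `I` of injective modules such that
`Hom_R(A, I)` is exact for all `A` in the class `𝓐`. -/
def IsGInjectiveRel (𝓐 : ModuleCat.{u} R → Prop) (M : ModuleCat.{u} R) : Prop :=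
  ∃ I : ChainComplex (ModuleCat.{u} R) ℤ,
    (∀ i, Injective (I.X i)) ∧ I.Acyclic ∧ Nonempty (M ≅ cokernel (I.d 1 0)) ∧
      ∀ A, 𝓐 A → HomExactFrom A I

/-- Gorenstein projective modules. -/
def IsGorensteinProjective (M : ModuleCat.{u} R) : Prop :=
  IsGProjectiveRel (fun L => Projective L) M

/-- Gorenstein AC-projective modules. -/
def IsGorensteinACProjective (M : ModuleCat.{u} R) : Prop :=
  IsGProjectiveRel (fun L => IsLevel L) M

/-- Gorenstein AC-injective modules. -/
def IsGorensteinACInjective (M : ModuleCat.{u} R) : Prop :=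
  IsGInjectiveRel (fun A => IsAbsolutelyClean A) M

/-! ### Dimensions -/

/-- There is an exact sequence `0 → G_n → ⋯ → G_0 → M → 0` with all `G_i` in the class `𝓧`.
The sequence is the complex `E`, with `M` in degree `0` and `G_i` in degree `i + 1`. -/
def HasLeftResolution (𝓧 : ModuleCat.{u} R → Prop) (n : ℕ) (M : ModuleCat.{u} R) : Prop :=
  ∃ E : ChainComplex (ModuleCat.{u} R) ℕ, E.Acyclic ∧ Nonempty (E.X 0 ≅ M) ∧
    (∀ i ≤ n, 𝓧 (E.X (i + 1))) ∧ ∀ i > n, IsZero (E.X (i + 1))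

/-- There is an exact sequence `0 → M → G^0 → ⋯ → G^n → 0` with all `G^i` in the class `𝓧`.
The sequence is the complex `E`, with `M` in degree `0` and `G^i` in degree `i + 1`. -/
def HasRightResolution (𝓧 : ModuleCat.{u} R → Prop) (n : ℕ) (M : ModuleCat.{u} R) : Prop :=
  ∃ E : CochainComplex (ModuleCat.{u} R) ℕ, E.Acyclic ∧ Nonempty (E.X 0 ≅ M) ∧
    (∀ i ≤ n, 𝓧 (E.X (i + 1))) ∧ ∀ i > n, IsZero (E.X (i + 1))

/-- The least length of a left resolution of `M` by modules in `𝓧` (`⊤` if there is none). -/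
def leftDim (𝓧 : ModuleCat.{u} R → Prop) (M : ModuleCat.{u} R) : ℕ∞ :=
  ⨅ (n : ℕ) (_ : HasLeftResolution 𝓧 n M), (n : ℕ∞)

/-- The least length of a right resolution of `M` by modules in `𝓧` (`⊤` if there is none). -/
def rightDim (𝓧 : ModuleCat.{u} R → Prop) (M : ModuleCat.{u} R) : ℕ∞ :=
  ⨅ (n : ℕ) (_ : HasRightResolution 𝓧 n M), (n : ℕ∞)

/-- The Gorenstein projective dimension of `M`. -/
def gorensteinProjectiveDim (M : ModuleCat.{u} R) : ℕ∞ :=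
  leftDim (fun G => IsGorensteinProjective G) M

/-- The Gorenstein AC-projective dimension of `M`. -/
def gorensteinACProjectiveDim (M : ModuleCat.{u} R) : ℕ∞ :=
  leftDim (fun G => IsGorensteinACProjective G) M

/-- The Gorenstein AC-injective dimension of `M`. -/
def gorensteinACInjectiveDim (M : ModuleCat.{u} R) : ℕ∞ :=
  rightDim (fun G => IsGorensteinACInjective G) M

end Modules

variable (R : Type u) [Ring R]

/-- The global Gorenstein (projective) dimension of `R`. -/
def globalGorensteinDim : ℕ∞ :=
  ⨆ M : ModuleCat.{u} R, gorensteinProjectiveDim M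

/-- The global Gorenstein AC-projective dimension of `R`. -/
def globalGorensteinACProjectiveDim : ℕ∞ :=
  ⨆ M : ModuleCat.{u} R, gorensteinACProjectiveDim M

/-- The global Gorenstein AC-injective dimension of `R`. -/
def globalGorensteinACInjectiveDim : ℕ∞ :=
  ⨆ M : ModuleCat.{u} R, gorensteinACInjectiveDim M

end GorAC

end

/-! Let n bound the Gorenstein projective dimensions. Gorenstein projective modules have no higher
Ext into projectives, so resolving an arbitrary M by them kills Ext^{n+1}(M, P) for P projective:
projectives have injective dimension at most n. Moreover M embeds in a module of projective
dimension at most n (`IsLeftResolved.exists_embedding`). If M is injective the embedding splits, so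
injectives have projective dimension at most n. The first bound also forces every finite projective
dimension to be at most n (`hasProjectiveDimensionLE_of_finite`), and every module of finite
projective dimension to have injective dimension at most n.

By dimension shifting, an acyclic complex of injectives is Hom(A, -)-exact when A has finite
projective dimension, and an acyclic complex of projectives is Hom(-, L)-exact when L has finite
injective dimension. So it suffices that absolutely clean, respectively level, modules have finite
projective dimension. Coherence supplies enough modules of type FP_∞ to make an absolutely clean
module pure in any module containing it, in particular in an injective one, and to make the kernel
of a free cover of a level module pure.

The core is `hasProjectiveDimensionLE_of_pure`: a pure submodule of a module of finite projective
dimension has projective dimension at most n. Passing to kernels of free covers reduces this to a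
pure submodule of a projective module. Countably generated pieces that are closed under local
retractions are projective by a telescoping argument. Larger ones are filtered by smaller ones and
handled by Auslander's lemma. The subquotients have dimension at most n + 1 a priori, but finite
dimensions are at most n, so the bound does not grow.

For (b), Gorenstein projective modules are then already Gorenstein AC-projective. For (a), the n-th
cosyzygy of any module is a cokernel in an acyclic complex of injectives
(`exists_injective_complex`), because n-th cosyzygies of projectives are injective. -/

namespace GorAC

/-! ### Short exact sequences of modules -/

section ShortExact

variable {R : Type u} [Ring R]

/-- `0 → A → B → C → 0` is exact. -/
structure IsSES {A B C : ModuleCat.{u} R} (f : A ⟶ B) (g : B ⟶ C) : Prop where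
  inj : Function.Injective f.hom
  exact : Function.Exact f.hom g.hom
  surj : Function.Surjective g.hom

namespace IsSES

variable {A B C M : ModuleCat.{u} R} {f : A ⟶ B} {g : B ⟶ C}

theorem comp_eq_zero (h : IsSES f g) : f ≫ g = 0 := by
  ext x
  exact h.exact.apply_apply_eq_zero x

theorem shortExact (h : IsSES f g) : (ShortComplex.mk f g h.comp_eq_zero).ShortExact :=
  ModuleCat.shortComplex_shortExact _ h.exact h.inj h.surj

theorem of_linearMap {A B C : Type u} [AddCommGroup A] [AddCommGroup B] [AddCommGroup C]
    [Module R A] [Module R B] [Module R C] {f : A →ₗ[R] B} {g : B →ₗ[R] C}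
    (hf : Function.Injective f) (hfg : Function.Exact f g) (hg : Function.Surjective g) :
    IsSES (ModuleCat.ofHom f) (ModuleCat.ofHom g) :=
  ⟨hf, hfg, hg⟩

theorem iso_right {C' : ModuleCat.{u} R} (h : IsSES f g) (e : C ≅ C') : IsSES f (g ≫ e.hom) := by
  refine ⟨h.inj, fun x => ?_, ?_⟩
  · rw [← h.exact x]
    change e.toLinearEquiv (g.hom x) = 0 ↔ _
    exact e.toLinearEquiv.map_eq_zero_iff
  · exact e.toLinearEquiv.surjective.comp h.surj

theorem iso_left {A' : ModuleCat.{u} R} (h : IsSES f g) (e : A' ≅ A) : IsSES (e.hom ≫ f) g := by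
  refine ⟨h.inj.comp e.toLinearEquiv.injective, fun x => ?_, h.surj⟩
  rw [h.exact x]
  exact ⟨fun ⟨y, hy⟩ => ⟨e.toLinearEquiv.symm y, by
    rw [← hy]; exact congrArg f.hom (e.toLinearEquiv.apply_symm_apply y)⟩,
    fun ⟨y, hy⟩ => ⟨e.toLinearEquiv y, hy⟩⟩

theorem exists_lift_of_ext_one (h : IsSES f g) (hM : Subsingleton (Abelian.Ext M A 1))
    (φ : M ⟶ C) : ∃ ψ : M ⟶ B, ψ ≫ g = φ := by
  obtain ⟨x, hx⟩ := Abelian.Ext.covariant_sequence_exact₃ M h.shortExact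
    (Abelian.Ext.mk₀ φ) (zero_add 1) (Subsingleton.elim _ _)
  obtain ⟨ψ, rfl⟩ := Abelian.Ext.homEquiv₀.symm.surjective x
  refine ⟨ψ, Abelian.Ext.homEquiv₀.symm.injective ?_⟩
  simpa using hx

theorem ext_one_of_exists_lift (h : IsSES f g) [Injective B]
    (H : ∀ φ : M ⟶ C, ∃ ψ : M ⟶ B, ψ ≫ g = φ) : Subsingleton (Abelian.Ext M A 1) := by
  refine subsingleton_of_forall_eq 0 fun x => ?_
  obtain ⟨y, rfl⟩ := Abelian.Ext.covariant_sequence_exact₁ M h.shortExact x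
    (Abelian.Ext.eq_zero_of_injective _) (zero_add 1)
  obtain ⟨φ, rfl⟩ := Abelian.Ext.homEquiv₀.symm.surjective y
  obtain ⟨ψ, rfl⟩ := H φ
  simp only [Abelian.Ext.homEquiv₀_symm_apply]
  rw [← Abelian.Ext.mk₀_comp_mk₀, Abelian.Ext.comp_assoc_of_second_deg_zero]
  erw [h.shortExact.comp_extClass]
  simp

theorem exists_extend_of_ext_one (h : IsSES f g) (hM : Subsingleton (Abelian.Ext C M 1))
    (φ : A ⟶ M) : ∃ ψ : B ⟶ M, f ≫ ψ = φ := by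
  obtain ⟨x, hx⟩ := Abelian.Ext.contravariant_sequence_exact₁ h.shortExact M
    (Abelian.Ext.mk₀ φ) (add_zero 1) (Subsingleton.elim _ _)
  obtain ⟨ψ, rfl⟩ := Abelian.Ext.homEquiv₀.symm.surjective x
  refine ⟨ψ, Abelian.Ext.homEquiv₀.symm.injective ?_⟩
  simpa using hx

theorem ext_one_of_exists_extend (h : IsSES f g) [Projective B]
    (H : ∀ φ : A ⟶ M, ∃ ψ : B ⟶ M, f ≫ ψ = φ) : Subsingleton (Abelian.Ext C M 1) := by
  refine subsingleton_of_forall_eq 0 fun x => ?_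
  obtain ⟨y, rfl⟩ := Abelian.Ext.contravariant_sequence_exact₃ h.shortExact M x
    (Abelian.Ext.eq_zero_of_projective _) (add_zero 1)
  obtain ⟨φ, rfl⟩ := Abelian.Ext.homEquiv₀.symm.surjective y
  obtain ⟨ψ, rfl⟩ := H φ
  simp only [Abelian.Ext.homEquiv₀_symm_apply]
  rw [← Abelian.Ext.mk₀_comp_mk₀]
  exact h.shortExact.extClass_comp_assoc (Abelian.Ext.mk₀ ψ)

theorem ext_left_succ (h : IsSES f g) {i : ℕ} (hA : Subsingleton (Abelian.Ext A M i))
    (hB : Subsingleton (Abelian.Ext B M (i + 1))) : Subsingleton (Abelian.Ext C M (i + 1)) := by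
  refine subsingleton_of_forall_eq 0 fun x => ?_
  obtain ⟨y, rfl⟩ := Abelian.Ext.contravariant_sequence_exact₃ h.shortExact M x
    (Subsingleton.elim _ _) (add_comm 1 i)
  rw [Subsingleton.elim (α := Abelian.Ext A M i) y 0, Abelian.Ext.comp_zero]

theorem ext_left_of_succ (h : IsSES f g) {i : ℕ} (hC : Subsingleton (Abelian.Ext C M (i + 1)))
    (hB : Subsingleton (Abelian.Ext B M i)) : Subsingleton (Abelian.Ext A M i) := by
  refine subsingleton_of_forall_eq 0 fun x => ?_
  obtain ⟨y, rfl⟩ := Abelian.Ext.contravariant_sequence_exact₁ h.shortExact M x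
    (add_comm 1 i) (Subsingleton.elim _ _)
  rw [Subsingleton.elim (α := Abelian.Ext B M i) y 0, Abelian.Ext.comp_zero]

theorem ext_left_middle (h : IsSES f g) {i : ℕ} (hA : Subsingleton (Abelian.Ext A M i))
    (hC : Subsingleton (Abelian.Ext C M i)) : Subsingleton (Abelian.Ext B M i) := by
  refine subsingleton_of_forall_eq 0 fun x => ?_
  obtain ⟨y, rfl⟩ := Abelian.Ext.contravariant_sequence_exact₂ h.shortExact M x
    (Subsingleton.elim _ _)
  rw [Subsingleton.elim (α := Abelian.Ext C M i) y 0, Abelian.Ext.comp_zero]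

theorem ext_right_succ (h : IsSES f g) {i : ℕ} (hC : Subsingleton (Abelian.Ext M C i))
    (hB : Subsingleton (Abelian.Ext M B (i + 1))) : Subsingleton (Abelian.Ext M A (i + 1)) := by
  refine subsingleton_of_forall_eq 0 fun x => ?_
  obtain ⟨y, rfl⟩ := Abelian.Ext.covariant_sequence_exact₁ M h.shortExact x
    (Subsingleton.elim _ _) rfl
  rw [Subsingleton.elim (α := Abelian.Ext M C i) y 0, Abelian.Ext.zero_comp]

theorem ext_right_of_succ (h : IsSES f g) {i : ℕ} (hA : Subsingleton (Abelian.Ext M A (i + 1)))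
    (hB : Subsingleton (Abelian.Ext M B i)) : Subsingleton (Abelian.Ext M C i) := by
  refine subsingleton_of_forall_eq 0 fun x => ?_
  obtain ⟨y, rfl⟩ := Abelian.Ext.covariant_sequence_exact₃ M h.shortExact x rfl
    (Subsingleton.elim _ _)
  rw [Subsingleton.elim (α := Abelian.Ext M B i) y 0, Abelian.Ext.zero_comp]

end IsSES

theorem isSES_subtype_mkQ {M : Type u} [AddCommGroup M] [Module R M] (N : Submodule R M) :
    IsSES (ModuleCat.ofHom N.subtype) (ModuleCat.ofHom N.mkQ) :=
  .of_linearMap N.injective_subtype (LinearMap.exact_subtype_mkQ N) N.mkQ_surjective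

theorem isSES_ker {M N : Type u} [AddCommGroup M] [Module R M] [AddCommGroup N] [Module R N]
    {f : M →ₗ[R] N} (hf : Function.Surjective f) :
    IsSES (ModuleCat.ofHom (LinearMap.ker f).subtype) (ModuleCat.ofHom f) :=
  .of_linearMap (LinearMap.ker f).injective_subtype (LinearMap.exact_subtype_ker_map f) hf

/-- A linear map that kills the kernel of a surjection `q` factors through `q`. -/
theorem exists_comp_eq_of_surjective {M N L : Type*} [AddCommGroup M] [AddCommGroup N]
    [AddCommGroup L] [Module R M] [Module R N] [Module R L] {q : M →ₗ[R] N}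
    (hq : Function.Surjective q) (φ : M →ₗ[R] L) (h : ∀ x, q x = 0 → φ x = 0) :
    ∃ ψ : N →ₗ[R] L, ∀ x, ψ (q x) = φ x := by
  refine ⟨(LinearMap.ker q).liftQ φ h ∘ₗ (q.quotKerEquivOfSurjective hq).symm.toLinearMap,
    fun x => ?_⟩
  have : (q.quotKerEquivOfSurjective hq).symm (q x) = (LinearMap.ker q).mkQ x := by
    rw [LinearEquiv.symm_apply_eq]; rfl
  rw [LinearMap.comp_apply, LinearEquiv.coe_coe, this]
  exact Submodule.liftQ_apply _ _ _

theorem exists_projective_isSES (M : ModuleCat.{u} R) : ∃ (K P : ModuleCat.{u} R) (f : K ⟶ P)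
    (g : P ⟶ M), Projective P ∧ IsSES f g := by
  have hs : Function.Surjective (Projective.π M).hom :=
    (ModuleCat.epi_iff_surjective _).1 inferInstance
  exact ⟨_, Projective.over M, _, _, inferInstance, isSES_ker hs⟩

theorem exists_injective_isSES (M : ModuleCat.{u} R) : ∃ (I C : ModuleCat.{u} R) (f : M ⟶ I)
    (g : I ⟶ C), Injective I ∧ IsSES f g := by
  have hi : Function.Injective (Injective.ι M).hom :=
    (ModuleCat.mono_iff_injective _).1 inferInstance
  exact ⟨Injective.under M, _, Injective.ι M, ModuleCat.ofHom (LinearMap.range _).mkQ,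
    inferInstance, hi, LinearMap.exact_map_mkQ_range _, Submodule.mkQ_surjective _⟩

/-- If projective modules have injective dimension at most `n`, then modules of finite projective
dimension have projective dimension at most `n`. -/
theorem hasProjectiveDimensionLE_of_finite {n : ℕ}
    (hP : ∀ P : ModuleCat.{u} R, Projective P → HasInjectiveDimensionLE P n)
    {M : ModuleCat.{u} R} {m : ℕ} (hM : HasProjectiveDimensionLT M m) :
    HasProjectiveDimensionLE M n := by
  obtain hm | ⟨k, rfl⟩ : m ≤ n + 1 ∨ ∃ k, m = n + 1 + k :=
    (le_total m (n + 1)).imp_right Nat.exists_eq_add_of_le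
  · exact hasProjectiveDimensionLT_of_ge M m (n + 1) hm
  induction k with
  | zero => exact hM
  | succ k ih =>
    -- Lower the bound by one: for 0 → K → P → Z → 0, the group Ext^{n+1+k}(M, Z) sits between
    -- Ext^{n+1+k}(M, P), zero by `hP`, and Ext^{n+2+k}(M, K), zero by assumption.
    refine ih (hasProjectiveDimensionLT_of_enoughInjectives M _ fun Z => ?_)
    obtain ⟨K, P, f, g, hPr, h⟩ := exists_projective_isSES Z
    have := hP P hPr
    exact h.ext_right_of_succ (HasProjectiveDimensionLT.subsingleton M _ _ le_rfl K)
      (HasInjectiveDimensionLT.subsingleton P (n + 1) _ (Nat.le_add_right _ _) M)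

end ShortExact

/-! ### Coresolvable modules and embeddings into modules of finite projective dimension -/

section Coresolving

variable {R : Type u} [Ring R]

/-- The horseshoe lemma for one step of a coresolution. -/
theorem exists_horseshoe {A B C I J A' C' : ModuleCat.{u} R} {f : A ⟶ B} {g : B ⟶ C}
    (h : IsSES f g) {a : A ⟶ I} {a' : I ⟶ A'} (ha : IsSES a a') {c : C ⟶ J} {c' : J ⟶ C'}
    (hc : IsSES c c') {e : B ⟶ I} (he : f ≫ e = a) :
    ∃ (B' : ModuleCat.{u} R) (b : B ⟶ I ⊞ J) (b' : I ⊞ J ⟶ B') (f' : A' ⟶ B') (g' : B' ⟶ C'),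
      IsSES b b' ∧ IsSES f' g' := by
  have hea : ∀ x, e.hom (f.hom x) = a.hom x := fun x => by rw [← he]; rfl
  let b : B →ₗ[R] I × J := e.hom.prod (c.hom ∘ₗ g.hom)
  have hb : ∀ x, b x = (e.hom x, c.hom (g.hom x)) := fun x => rfl
  have hbi : Function.Injective b := by
    rw [injective_iff_map_eq_zero]
    intro x hx
    rw [hb, Prod.mk_eq_zero] at hx
    obtain ⟨y, rfl⟩ := (h.exact x).1 ((injective_iff_map_eq_zero _).1 hc.inj _ hx.2)
    rw [hea] at hx
    rw [(injective_iff_map_eq_zero _).1 ha.inj _ hx.1, map_zero]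
  let q := (LinearMap.range b).mkQ
  have hq0 : ∀ x, q x = 0 ↔ ∃ y, b y = x := fun x => by
    rw [Submodule.mkQ_apply, Submodule.Quotient.mk_eq_zero, LinearMap.mem_range]
  have hqs : Function.Surjective q := Submodule.mkQ_surjective _
  obtain ⟨f', hf'⟩ := exists_comp_eq_of_surjective ha.surj (q ∘ₗ LinearMap.inl R I J)
    (fun x hx => by
      obtain ⟨y, rfl⟩ := (ha.exact x).1 hx
      refine (hq0 _).2 ⟨f.hom y, ?_⟩
      rw [hb, hea, h.exact.apply_apply_eq_zero, map_zero]
      rfl)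
  obtain ⟨g', hg'⟩ := exists_comp_eq_of_surjective hqs (c'.hom ∘ₗ LinearMap.snd R I J)
    (fun x hx => by
      obtain ⟨y, rfl⟩ := (hq0 _).1 hx
      exact hc.exact.apply_apply_eq_zero _)
  refine ⟨ModuleCat.of R ((I × J) ⧸ LinearMap.range b),
    ModuleCat.ofHom b ≫ (ModuleCat.biprodIsoProd I J).inv,
    (ModuleCat.biprodIsoProd I J).hom ≫ ModuleCat.ofHom q, ModuleCat.ofHom f',
    ModuleCat.ofHom g', ?_, ?_⟩
  · refine ⟨?_, ?_, ?_⟩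
    · exact (ModuleCat.biprodIsoProd I J).symm.toLinearEquiv.injective.comp hbi
    · intro x
      refine (hq0 _).trans ⟨fun ⟨y, hy⟩ => ⟨y, ?_⟩, fun ⟨y, hy⟩ => ⟨y, ?_⟩⟩
      · exact ((ModuleCat.biprodIsoProd I J).toLinearEquiv.symm_apply_eq).2 hy
      · exact ((ModuleCat.biprodIsoProd I J).toLinearEquiv.symm_apply_eq).1 hy
    · exact hqs.comp (ModuleCat.biprodIsoProd I J).toLinearEquiv.surjective
  · refine .of_linearMap ?_ ?_ ?_
    · rw [injective_iff_map_eq_zero]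
      intro x hx
      obtain ⟨x, rfl⟩ := ha.surj x
      obtain ⟨y, hy⟩ := (hq0 _).1 ((hf' x).symm.trans hx)
      rw [hb] at hy
      obtain ⟨h1, h2⟩ := Prod.ext_iff.1 hy
      obtain ⟨z, rfl⟩ := (h.exact y).1 ((injective_iff_map_eq_zero _).1 hc.inj _ h2)
      have h1 : a.hom z = x := (hea z).symm.trans h1
      rw [← h1, ha.exact.apply_apply_eq_zero]
    · intro x
      obtain ⟨⟨i, j⟩, rfl⟩ := hqs x
      rw [hg']
      constructor
      · intro hx
        obtain ⟨z, hz⟩ := (hc.exact j).1 hx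
        obtain ⟨y, rfl⟩ := h.surj z
        -- Since j = c (g y), subtracting b y from (i, j) leaves (i - e y, 0).
        refine ⟨a'.hom (i - e.hom y), ?_⟩
        rw [hf', ← sub_eq_zero, LinearMap.comp_apply, ← map_sub]
        refine (hq0 _).2 ⟨-y, ?_⟩
        rw [map_neg, hb, hz]
        simp
      · rintro ⟨y, hy⟩
        obtain ⟨y, rfl⟩ := ha.surj y
        rw [hf'] at hy
        rw [← hg' (i, j), ← hy, LinearMap.comp_apply, hg']
        simp
    · intro x
      obtain ⟨y, rfl⟩ := hc.surj x
      exact ⟨q (0, y), hg' _⟩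

/-- The pushout of a short exact sequence along a monomorphism. -/
theorem exists_pushout {K G M H G' : ModuleCat.{u} R} {f : K ⟶ G} {g : G ⟶ M} (hfg : IsSES f g)
    {h : K ⟶ H} {p : H ⟶ G'} (hp : IsSES h p) :
    ∃ (D : ModuleCat.{u} R) (i : H ⟶ D) (q : D ⟶ M) (j : G ⟶ D) (r : D ⟶ G'),
      IsSES i q ∧ IsSES j r := by
  let b : K →ₗ[R] G × H := f.hom.prod (-h.hom)
  have hb : ∀ x, b x = (f.hom x, -h.hom x) := fun x => rfl
  let q := (LinearMap.range b).mkQ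
  have hq0 : ∀ x, q x = 0 ↔ ∃ y, b y = x := fun x => by
    rw [Submodule.mkQ_apply, Submodule.Quotient.mk_eq_zero, LinearMap.mem_range]
  have hqs : Function.Surjective q := Submodule.mkQ_surjective _
  obtain ⟨g', hg'⟩ := exists_comp_eq_of_surjective hqs (g.hom ∘ₗ LinearMap.fst R G H)
    (fun x hx => by
      obtain ⟨y, rfl⟩ := (hq0 _).1 hx
      exact hfg.exact.apply_apply_eq_zero _)
  obtain ⟨p', hp'⟩ := exists_comp_eq_of_surjective hqs (p.hom ∘ₗ LinearMap.snd R G H)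
    (fun x hx => by
      obtain ⟨y, rfl⟩ := (hq0 _).1 hx
      simp [hb, hp.exact.apply_apply_eq_zero])
  refine ⟨ModuleCat.of R ((G × H) ⧸ LinearMap.range b),
    ModuleCat.ofHom (q ∘ₗ LinearMap.inr R G H), ModuleCat.ofHom g',
    ModuleCat.ofHom (q ∘ₗ LinearMap.inl R G H), ModuleCat.ofHom p',
    .of_linearMap ?_ ?_ ?_, .of_linearMap ?_ ?_ ?_⟩
  · rw [injective_iff_map_eq_zero]
    intro x hx
    obtain ⟨y, hy⟩ := (hq0 _).1 hx
    obtain ⟨h1, h2⟩ := Prod.ext_iff.1 hy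
    have h1 := (injective_iff_map_eq_zero _).1 hfg.inj y h1
    subst h1
    simpa [hb] using h2.symm
  · intro x
    obtain ⟨⟨i, j⟩, rfl⟩ := hqs x
    rw [hg']
    constructor
    · intro hx
      obtain ⟨z, hz⟩ := (hfg.exact i).1 hx
      refine ⟨j + h.hom z, ?_⟩
      rw [← sub_eq_zero, LinearMap.comp_apply, ← map_sub]
      exact (hq0 _).2 ⟨-z, by simp [hb, hz]⟩
    · rintro ⟨y, hy⟩
      rw [← hg' (i, j), ← hy, LinearMap.comp_apply, hg']
      simp
  · intro x
    obtain ⟨y, rfl⟩ := hfg.surj x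
    exact ⟨q (y, 0), hg' _⟩
  · rw [injective_iff_map_eq_zero]
    intro x hx
    obtain ⟨y, hy⟩ := (hq0 _).1 hx
    obtain ⟨h1, h2⟩ := Prod.ext_iff.1 hy
    have h2 := (injective_iff_map_eq_zero _).1 hp.inj y (neg_eq_zero.1 h2)
    subst h2
    simpa [hb] using h1.symm
  · intro x
    obtain ⟨⟨i, j⟩, rfl⟩ := hqs x
    rw [hp']
    constructor
    · intro hx
      obtain ⟨z, hz⟩ := (hp.exact j).1 hx
      refine ⟨i + f.hom z, ?_⟩
      rw [← sub_eq_zero, LinearMap.comp_apply, ← map_sub]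
      exact (hq0 _).2 ⟨z, by simp [hb, hz]⟩
    · rintro ⟨y, hy⟩
      rw [← hp' (i, j), ← hy, LinearMap.comp_apply, hp']
      simp
  · intro x
    obtain ⟨y, rfl⟩ := hp.surj x
    exact ⟨q (0, y), hp' _⟩

/-- For submodules `H ⊆ D ⊆ P`, the exact sequence `0 → D/H → P/H → P/D → 0`. -/
theorem exists_quotient_isSES {H D M P G : ModuleCat.{u} R} {i : H ⟶ D} {q : D ⟶ M}
    (hiq : IsSES i q) {j : D ⟶ P} {r : P ⟶ G} (hjr : IsSES j r) :
    ∃ (Q : ModuleCat.{u} R) (t : P ⟶ Q) (m : M ⟶ Q) (s : Q ⟶ G),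
      IsSES (i ≫ j) t ∧ IsSES m s := by
  let b : H →ₗ[R] P := j.hom ∘ₗ i.hom
  let t := (LinearMap.range b).mkQ
  have ht0 : ∀ x, t x = 0 ↔ ∃ y, b y = x := fun x => by
    rw [Submodule.mkQ_apply, Submodule.Quotient.mk_eq_zero, LinearMap.mem_range]
  have hts : Function.Surjective t := Submodule.mkQ_surjective _
  obtain ⟨m, hm⟩ := exists_comp_eq_of_surjective hiq.surj (t ∘ₗ j.hom) (fun x hx => by
      obtain ⟨y, rfl⟩ := (hiq.exact x).1 hx
      exact (ht0 _).2 ⟨y, rfl⟩)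
  obtain ⟨s, hs⟩ := exists_comp_eq_of_surjective hts r.hom (fun x hx => by
      obtain ⟨y, rfl⟩ := (ht0 _).1 hx
      exact hjr.exact.apply_apply_eq_zero _)
  refine ⟨ModuleCat.of R (P ⧸ LinearMap.range b), ModuleCat.ofHom t, ModuleCat.ofHom m,
    ModuleCat.ofHom s, ⟨hjr.inj.comp hiq.inj, fun x => ht0 x, hts⟩, .of_linearMap ?_ ?_ ?_⟩
  · rw [injective_iff_map_eq_zero]
    intro x hx
    obtain ⟨x, rfl⟩ := hiq.surj x
    obtain ⟨y, hy⟩ := (ht0 _).1 ((hm x).symm.trans hx)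
    rw [← hjr.inj hy, hiq.exact.apply_apply_eq_zero]
  · intro x
    obtain ⟨x, rfl⟩ := hts x
    rw [hs]
    constructor
    · intro hx
      obtain ⟨z, rfl⟩ := (hjr.exact x).1 hx
      exact ⟨q.hom z, hm z⟩
    · rintro ⟨y, hy⟩
      obtain ⟨y, rfl⟩ := hiq.surj y
      rw [← hs x, ← hy, hm, LinearMap.comp_apply, hs]
      exact hjr.exact.apply_apply_eq_zero _
  · intro x
    obtain ⟨y, rfl⟩ := hjr.surj x
    exact ⟨t y, hs _⟩

/-- Each `G` in the class `S` satisfies `Ext^i(G, P) = 0` for `i > 0` and `P` projective, and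
embeds into a projective module with cokernel in `S`. -/
def IsCoresolvingClass (S : ModuleCat.{u} R → Prop) : Prop :=
  ∀ G, S G → (∀ L, Projective L → ∀ i, Subsingleton (Abelian.Ext G L (i + 1))) ∧
    ∃ (P G' : ModuleCat.{u} R) (f : G ⟶ P) (g : P ⟶ G'), Projective P ∧ S G' ∧ IsSES f g

/-- The largest coresolving class. -/
def IsCoresolvable (G : ModuleCat.{u} R) : Prop :=
  ∃ S : ModuleCat.{u} R → Prop, IsCoresolvingClass S ∧ S G

theorem IsCoresolvable.ext_eq_zero {G L : ModuleCat.{u} R} (hG : IsCoresolvable G)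
    (hL : Projective L) (i : ℕ) : Subsingleton (Abelian.Ext G L (i + 1)) := by
  obtain ⟨S, hS, h⟩ := hG
  exact (hS G h).1 L hL i

theorem IsCoresolvable.exists_isSES {G : ModuleCat.{u} R} (hG : IsCoresolvable G) :
    ∃ (P G' : ModuleCat.{u} R) (f : G ⟶ P) (g : P ⟶ G'),
      Projective P ∧ IsCoresolvable G' ∧ IsSES f g := by
  obtain ⟨S, hS, h⟩ := hG
  obtain ⟨P, G', f, g, hP, hG', hfg⟩ := (hS G h).2
  exact ⟨P, G', f, g, hP, ⟨S, hS, hG'⟩, hfg⟩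

/-- Extensions of coresolvable modules form a coresolving class: Ext¹(C, P) = 0 extends A → P to B,
and the horseshoe lemma then embeds B in P ⊞ Q with cokernel again such an extension. -/
theorem IsCoresolvable.of_isSES {A B C : ModuleCat.{u} R} {f : A ⟶ B} {g : B ⟶ C}
    (h : IsSES f g) (hA : IsCoresolvable A) (hC : IsCoresolvable C) : IsCoresolvable B := by
  refine ⟨fun B => ∃ (A C : ModuleCat.{u} R) (f : A ⟶ B) (g : B ⟶ C),
    IsSES f g ∧ IsCoresolvable A ∧ IsCoresolvable C, ?_, A, C, f, g, h, hA, hC⟩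
  rintro B ⟨A, C, f, g, h, hA, hC⟩
  refine ⟨fun L hL i => h.ext_left_middle (hA.ext_eq_zero hL i) (hC.ext_eq_zero hL i), ?_⟩
  obtain ⟨P, A', a, a', hP, hA', haa⟩ := hA.exists_isSES
  obtain ⟨Q, C', c, c', hQ, hC', hcc⟩ := hC.exists_isSES
  obtain ⟨e, he⟩ := h.exists_extend_of_ext_one (hC.ext_eq_zero hP 0) a
  obtain ⟨B', b, b', f', g', hbb, hfg'⟩ := exists_horseshoe h haa hcc he
  exact ⟨P ⊞ Q, B', b, b', inferInstance, ⟨A', C', f', g', hfg', hA', hC'⟩, hbb⟩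

/-- There is an exact sequence `0 → G_n → ⋯ → G_0 → M → 0` with all `G_i` in the class `𝓧`,
presented as a sequence of short exact sequences. -/
def IsLeftResolved (𝓧 : ModuleCat.{u} R → Prop) : ℕ → ModuleCat.{u} R → Prop
  | 0, M => 𝓧 M
  | n + 1, M => ∃ (K G : ModuleCat.{u} R) (f : K ⟶ G) (g : G ⟶ M),
      IsSES f g ∧ 𝓧 G ∧ IsLeftResolved 𝓧 n K

theorem IsLeftResolved.ext_eq_zero {n : ℕ} {M L : ModuleCat.{u} R}
    (h : IsLeftResolved IsCoresolvable n M) (hL : Projective L) (i : ℕ) :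
    Subsingleton (Abelian.Ext M L (i + n + 1)) := by
  induction n generalizing M with
  | zero => exact IsCoresolvable.ext_eq_zero h hL i
  | succ n ih =>
    obtain ⟨K, G, f, g, hfg, hG, hK⟩ := h
    exact hfg.ext_left_succ (ih hK) (hG.ext_eq_zero hL _)

/-- Inductively K embeds in H with coresolvable cokernel. The pushout D of H and G over K is an
extension of coresolvable modules, so it embeds in a projective P with coresolvable cokernel. As D/H
= M, the module P/H contains M with that same cokernel, and its projective dimension exceeds that of
H by at most one. -/
theorem IsLeftResolved.exists_embedding {n : ℕ} {M : ModuleCat.{u} R}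
    (h : IsLeftResolved IsCoresolvable n M) : ∃ (H G : ModuleCat.{u} R) (f : M ⟶ H) (g : H ⟶ G),
      HasProjectiveDimensionLE H n ∧ IsCoresolvable G ∧ IsSES f g := by
  induction n generalizing M with
  | zero =>
    obtain ⟨P, G, f, g, hP, hG, hfg⟩ := IsCoresolvable.exists_isSES h
    exact ⟨P, G, f, g, inferInstance, hG, hfg⟩
  | succ n ih =>
    obtain ⟨K, G, f, g, hfg, hG, hK⟩ := h
    obtain ⟨H, G', h, p, hH, hG', hp⟩ := ih hK
    obtain ⟨D, i, q, j, r, hiq, hjr⟩ := exists_pushout hfg hp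
    obtain ⟨P, G'', j', r', hP, hG'', hjr'⟩ := (hG.of_isSES hjr hG').exists_isSES
    obtain ⟨Q, t, m, s, ht, hms⟩ := exists_quotient_isSES hiq hjr'
    refine ⟨Q, G'', m, s, ?_, hG'', hms⟩
    exact ht.shortExact.hasProjectiveDimensionLT_X₃ (n + 1) hH
      (hasProjectiveDimensionLT_of_ge P 1 _ (by lia))

theorem IsLeftResolved.hasProjectiveDimensionLE_of_injective {n : ℕ} {E : ModuleCat.{u} R}
    (h : IsLeftResolved IsCoresolvable n E) [Injective E] : HasProjectiveDimensionLE E n := by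
  obtain ⟨H, G, f, g, hH, -, hfg⟩ := h.exists_embedding
  have : Mono f := (ModuleCat.mono_iff_injective f).2 hfg.inj
  exact Retract.hasProjectiveDimensionLT
    ⟨f, Injective.factorThru (𝟙 E) f, Injective.comp_factorThru _ _⟩ _

end Coresolving

/-! ### Syzygies of acyclic complexes, written as cokernels -/

section Complexes

variable {R : Type u} [Ring R]

theorem isSES_cokernel {A B C : ModuleCat.{u} R} {f : A ⟶ B} {g : B ⟶ C} {w : f ≫ g = 0}
    (h : (ShortComplex.mk f g w).Exact) : IsSES (cokernel.desc f g w) (cokernel.π g) := by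
  have hs : Function.Surjective (cokernel.π f).hom :=
    (ModuleCat.epi_iff_surjective _).1 inferInstance
  refine ⟨(ModuleCat.mono_iff_injective _).1 h.mono_cokernelDesc, fun x => ?_,
    (ModuleCat.epi_iff_surjective _).1 inferInstance⟩
  have hx := (ShortComplex.ShortExact.moduleCat_exact_iff_function_exact _).1
    (ShortComplex.exact_cokernel g) x
  refine hx.trans ⟨fun ⟨y, hy⟩ => ⟨cokernel.π f y, ?_⟩, fun ⟨y, hy⟩ => ?_⟩
  · rw [← hy]
    exact ConcreteCategory.congr_hom (cokernel.π_desc f g w) y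
  · obtain ⟨y, rfl⟩ := hs y
    exact ⟨y, by rw [← hy]; exact (ConcreteCategory.congr_hom (cokernel.π_desc f g w) y).symm⟩

theorem isSES_cokernel_d {P : ChainComplex (ModuleCat.{u} R) ℤ} (hP : P.Acyclic) (i : ℤ) :
    IsSES (cokernel.desc (P.d (i + 1 + 1) (i + 1)) (P.d (i + 1) i) (P.d_comp_d _ _ _))
      (cokernel.π (P.d (i + 1) i)) :=
  isSES_cokernel ((P.exactAt_iff' (i + 1 + 1) (i + 1) i (by simp) (by simp)).1 (hP (i + 1)))

/-- Exactness of Hom(P, L) is an extension property along the embedded cokernels, since a map on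
P_{i+1} that kills boundaries is a map on the cokernel. -/
theorem HomExactInto.exists_extend {P : ChainComplex (ModuleCat.{u} R) ℤ} {L : ModuleCat.{u} R}
    (h : HomExactInto P L) (i : ℤ) (φ : cokernel (P.d (i + 1 + 1) (i + 1)) ⟶ L) :
    ∃ ψ : P.X i ⟶ L,
      cokernel.desc (P.d (i + 1 + 1) (i + 1)) (P.d (i + 1) i) (P.d_comp_d _ _ _) ≫ ψ = φ := by
  obtain ⟨ψ, hψ⟩ := (h i (cokernel.π _ ≫ φ)).1 (by simp)
  refine ⟨ψ, ?_⟩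
  rw [← cancel_epi (cokernel.π _), cokernel.π_desc_assoc]
  exact hψ

theorem HomExactInto.of_exists_extend {P : ChainComplex (ModuleCat.{u} R) ℤ}
    {L : ModuleCat.{u} R}
    (h : ∀ (i : ℤ) (φ : cokernel (P.d (i + 1 + 1) (i + 1)) ⟶ L), ∃ ψ : P.X i ⟶ L,
      cokernel.desc (P.d (i + 1 + 1) (i + 1)) (P.d (i + 1) i) (P.d_comp_d _ _ _) ≫ ψ = φ) :
    HomExactInto P L := by
  refine fun i φ => ⟨fun hφ => ?_, ?_⟩
  · obtain ⟨ψ, hψ⟩ := h i (cokernel.desc _ φ hφ)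
    refine ⟨ψ, ?_⟩
    have := congrArg (fun t => cokernel.π _ ≫ t) hψ
    simpa using this
  · rintro ⟨ψ, rfl⟩
    simp

theorem HomExactFrom.of_exists_lift {I : ChainComplex (ModuleCat.{u} R) ℤ} (hI : I.Acyclic)
    {A : ModuleCat.{u} R} (h : ∀ (i : ℤ) (φ : A ⟶ cokernel (I.d (i + 1) i)),
      ∃ ψ : A ⟶ I.X i, ψ ≫ cokernel.π (I.d (i + 1) i) = φ) : HomExactFrom A I := by
  refine fun i φ => ⟨fun hφ => ?_, ?_⟩
  · have h1 := isSES_cokernel_d hI (i + 1)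
    have h0 := isSES_cokernel_d hI i
    have : Mono (cokernel.desc (I.d (i + 1 + 1) (i + 1)) (I.d (i + 1) i) (I.d_comp_d _ _ _)) :=
      (ModuleCat.mono_iff_injective _).2 h0.inj
    have hφ' : φ ≫ cokernel.π (I.d (i + 1 + 1) (i + 1)) = 0 := by
      rw [← cancel_mono (cokernel.desc (I.d (i + 1 + 1) (i + 1)) (I.d (i + 1) i)
        (I.d_comp_d _ _ _)), Category.assoc, cokernel.π_desc, zero_comp]
      exact hφ
    have := h1.shortExact.mono_f
    obtain ⟨χ, hχ⟩ := h1.shortExact.exact.lift' φ hφ'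
    obtain ⟨ψ, hψ⟩ := h _ χ
    refine ⟨ψ, ?_⟩
    dsimp at hχ ⊢
    rw [← hχ, ← hψ, Category.assoc, cokernel.π_desc]
  · rintro ⟨ψ, rfl⟩
    simp

/-- All cokernels of the complex together form a coresolving class. Hom-exactness gives the
vanishing of Ext¹ for each of them, and dimension shifting gives the higher degrees. -/
theorem IsGorensteinProjective.isCoresolvable {G : ModuleCat.{u} R}
    (hG : IsGorensteinProjective G) : IsCoresolvable G := by
  obtain ⟨P, hP, hPa, ⟨e⟩, hL⟩ := hG
  refine ⟨fun G => ∃ i : ℤ, Nonempty (G ≅ cokernel (P.d (i + 1) i)), ?_, 0, by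
    rw [zero_add]
    exact ⟨e⟩⟩
  rintro G ⟨i, ⟨e⟩⟩
  constructor
  · intro L hLp k
    have key : ∀ i, Subsingleton (Abelian.Ext (cokernel (P.d (i + 1) i)) L (k + 1)) := by
      induction k with
      | zero =>
        intro i
        exact (isSES_cokernel_d hPa i).ext_one_of_exists_extend ((hL L hLp).exists_extend i)
      | succ k ih =>
        intro i
        exact (isSES_cokernel_d hPa i).ext_left_succ (ih _)
          (Abelian.Ext.subsingleton_of_projective _ _ _)
    have := key i
    refine subsingleton_of_forall_eq 0 fun x => ?_
    have hx : (Abelian.Ext.mk₀ e.inv).comp x (zero_add _) = 0 := Subsingleton.elim _ _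
    have := congrArg (fun y => (Abelian.Ext.mk₀ e.hom).comp y (zero_add _)) hx
    simpa using this
  · obtain ⟨j, rfl⟩ : ∃ j, i = j + 1 := ⟨i - 1, by ring⟩
    exact ⟨P.X j, _, _, _, hP j, ⟨j, ⟨Iso.refl _⟩⟩, (isSES_cokernel_d hPa j).iso_left e⟩

theorem IsLeftResolved.of_iso {𝓧 : ModuleCat.{u} R → Prop}
    (h𝓧 : ∀ {M N : ModuleCat.{u} R}, (M ≅ N) → 𝓧 M → 𝓧 N) {n : ℕ} {M N : ModuleCat.{u} R}
    (e : M ≅ N) (h : IsLeftResolved 𝓧 n M) : IsLeftResolved 𝓧 n N := by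
  cases n with
  | zero => exact h𝓧 e h
  | succ n =>
    obtain ⟨K, G, f, g, hfg, hG, hK⟩ := h
    exact ⟨K, G, f, g ≫ e.hom, hfg.iso_right e, hG, hK⟩

theorem IsLeftResolved.mono {𝓧 𝓨 : ModuleCat.{u} R → Prop} (h𝓧 : ∀ M, 𝓧 M → 𝓨 M) {n : ℕ}
    {M : ModuleCat.{u} R} (h : IsLeftResolved 𝓧 n M) : IsLeftResolved 𝓨 n M := by
  induction n generalizing M with
  | zero => exact h𝓧 M h
  | succ n ih =>
    obtain ⟨K, G, f, g, hfg, hG, hK⟩ := h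
    exact ⟨K, G, f, g, hfg, h𝓧 G hG, ih hK⟩

theorem HasLeftResolution.isLeftResolved {𝓧 : ModuleCat.{u} R → Prop}
    (h𝓧 : ∀ {M N : ModuleCat.{u} R}, (M ≅ N) → 𝓧 M → 𝓧 N) {n : ℕ} {M : ModuleCat.{u} R}
    (h : HasLeftResolution 𝓧 n M) : IsLeftResolved 𝓧 n M := by
  obtain ⟨E, hE, ⟨e⟩, hX, hZ⟩ := h
  have ses : ∀ i : ℕ, IsSES
      (cokernel.desc (E.d (i + 1 + 1) (i + 1)) (E.d (i + 1) i) (E.d_comp_d _ _ _))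
      (cokernel.π (E.d (i + 1) i)) := fun i =>
    isSES_cokernel ((E.exactAt_iff' (i + 1 + 1) (i + 1) i (by simp) (by simp)).1 (hE (i + 1)))
  -- As M sits in degree 0, the cokernel of d : E_{i+2} → E_{i+1} is the i-th syzygy of M, and n - i
  -- steps remain.
  have key : ∀ k i, i + k = n → IsLeftResolved 𝓧 k (cokernel (E.d (i + 1 + 1) (i + 1))) := by
    intro k
    induction k with
    | zero =>
      rintro i rfl
      have h0 : E.d (i + 1 + 1) (i + 1) = 0 := (hZ (i + 1) (by lia)).eq_of_src _ _
      exact h𝓧 ((cokernelIsoOfEq h0).trans cokernelZeroIsoTarget).symm (hX i (by lia))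
    | succ k ih =>
      intro i hi
      exact ⟨_, _, _, _, ses (i + 1), hX i (by lia), ih (i + 1) (by lia)⟩
  -- Exactness in degrees 1 and 0 makes the 0-th syzygy isomorphic to E_0, that is, to M.
  have hepi : Epi (E.d 1 0) := by
    have := (E.exactAt_iff' 1 0 0 (by simp) (by simp)).1 (hE 0)
    exact (ShortComplex.exact_iff_epi _ (E.shape _ _ (by simp))).1 this
  have := (ses 0).shortExact.mono_f
  have hepi' : Epi (cokernel.desc (E.d (0 + 1 + 1) (0 + 1)) (E.d (0 + 1) 0)
      (E.d_comp_d _ _ _)) := by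
    refine @epi_of_epi_fac _ _ _ _ _ (cokernel.π (E.d (0 + 1 + 1) (0 + 1))) _ (E.d 1 0) hepi ?_
    exact cokernel.π_desc _ _ _
  have : IsIso (cokernel.desc (E.d (0 + 1 + 1) (0 + 1)) (E.d (0 + 1) 0)
      (E.d_comp_d _ _ _)) := isIso_of_mono_of_epi _
  exact (key n 0 (zero_add n)).of_iso h𝓧 ((asIso (cokernel.desc (E.d (0 + 1 + 1) (0 + 1))
    (E.d (0 + 1) 0) (E.d_comp_d _ _ _))).trans e)

end Complexes

/-! ### Splicing short exact sequences into complexes and resolutions -/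

section Splicing

variable {R : Type u} [Ring R]

theorem exact_splice {A K B L C : ModuleCat.{u} R} {p : A ⟶ K} {i : K ⟶ B} {q : B ⟶ L}
    {j : L ⟶ C} (hp : Function.Surjective p.hom) (h : IsSES i q) (hj : Function.Injective j.hom)
    (w : (p ≫ i) ≫ q ≫ j = 0) : (ShortComplex.mk (p ≫ i) (q ≫ j) w).Exact := by
  refine (ShortComplex.ShortExact.moduleCat_exact_iff_function_exact _).2 fun x => ?_
  constructor
  · intro hx
    obtain ⟨y, rfl⟩ := (h.exact x).1 ((injective_iff_map_eq_zero _).1 hj _ hx)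
    obtain ⟨z, rfl⟩ := hp y
    exact ⟨z, rfl⟩
  · rintro ⟨y, rfl⟩
    exact congrArg (fun f => f.hom y) w

theorem splice_comp_eq_zero {A K B L C : ModuleCat.{u} R} {p : A ⟶ K} {i : K ⟶ B} {q : B ⟶ L}
    {j : L ⟶ C} (h : IsSES i q) : (p ≫ i) ≫ q ≫ j = 0 := by
  rw [Category.assoc, reassoc_of% h.comp_eq_zero, zero_comp, comp_zero]

section Chain

variable {α : Type*} [AddRightCancelSemigroup α] [One α] [DecidableEq α]
  {E Z : α → ModuleCat.{u} R} {ι : ∀ i, Z (i + 1) ⟶ E i} {π : ∀ i, E i ⟶ Z i}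
  (h : ∀ i, IsSES (ι i) (π i))

/-- The chain complex obtained by splicing short exact sequences. -/
noncomputable def spliceChain : ChainComplex (ModuleCat.{u} R) α :=
  ChainComplex.of E (fun i => π (i + 1) ≫ ι i) fun i => splice_comp_eq_zero (h (i + 1))

theorem spliceChain_d (i : α) : (spliceChain h).d (i + 1) i = π (i + 1) ≫ ι i :=
  ChainComplex.of_d E (fun i => π (i + 1) ≫ ι i) i

theorem spliceChain_exactAt (i : α) : (spliceChain h).ExactAt (i + 1) := by
  rw [(spliceChain h).exactAt_iff' (i + 1 + 1) (i + 1) i (ComplexShape.prev_eq' _ rfl)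
    (ComplexShape.next_eq' _ rfl)]
  have := exact_splice (h (i + 1 + 1)).surj (h (i + 1)) (h i).inj
    (splice_comp_eq_zero (h (i + 1)))
  convert this using 1
  dsimp only [HomologicalComplex.sc', HomologicalComplex.shortComplexFunctor']
  congr 1 <;> exact spliceChain_d h _

theorem nonempty_cokernel_spliceChain_iso (i : α) :
    Nonempty (cokernel ((spliceChain h).d (i + 1) i) ≅ Z i) := by
  have : Epi (π (i + 1)) := (ModuleCat.epi_iff_surjective _).2 (h (i + 1)).surj
  have e : cokernel (π (i + 1) ≫ ι i) ≅ Z i := (cokernelEpiComp _ _).trans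
    ((cokernelIsCokernel (ι i)).coconePointUniqueUpToIso (h i).shortExact.gIsCokernel)
  exact ⟨(cokernelIsoOfEq (spliceChain_d h i)).trans e⟩

end Chain

/-- The projective resolution obtained by splicing short exact sequences. -/
noncomputable def spliceResolution {E Z : ℕ → ModuleCat.{u} R} {ι : ∀ i, Z (i + 1) ⟶ E i}
    {π : ∀ i, E i ⟶ Z i} (h : ∀ i, IsSES (ι i) (π i)) (hE : ∀ i, Projective (E i)) :
    ProjectiveResolution (Z 0) where
  complex := spliceChain h
  projective := hE
  π := ((spliceChain h).toSingle₀Equiv (Z 0)).symm ⟨π 0, by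
    refine (congrArg (· ≫ π 0) (spliceChain_d h 0)).trans ?_
    exact (Category.assoc (π 1) (ι 0) (π 0)).trans
      ((congrArg (π 1 ≫ ·) (h 0).comp_eq_zero).trans comp_zero)⟩
  quasiIso := ⟨fun n => by
    cases n with
    | zero =>
      rw [ChainComplex.quasiIsoAt₀_iff, ShortComplex.quasiIso_iff_of_zeros' _ rfl rfl rfl]
      have hs := exact_splice (h 1).surj (h 0) (j := 𝟙 _) Function.injective_id
        (splice_comp_eq_zero (h 0))
      have : Epi (π 0) := (ModuleCat.epi_iff_surjective _).2 (h 0).surj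
      refine (ShortComplex.exact_and_epi_g_iff_of_iso ?_).2
        ⟨hs, by dsimp; rw [Category.comp_id]; exact this⟩
      refine ShortComplex.isoMk (Iso.refl _) (Iso.refl _) (Iso.refl _) ?_ ?_
      · exact (Category.id_comp _).trans
          ((spliceChain_d h 0).symm.trans (Category.comp_id _).symm)
      · refine (Category.id_comp _).trans (Eq.trans ?_ (Category.comp_id _).symm)
        exact (Category.comp_id _).trans
          (ChainComplex.toSingle₀Equiv_symm_apply_f_zero (C := spliceChain h) _ _).symm
    | succ n =>
      rw [quasiIsoAt_iff_exactAt']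
      · exact spliceChain_exactAt h n
      · exact ChainComplex.exactAt_succ_single_obj _ _⟩

/-- Dependent choice in both directions from x. It turns one-step extensions to the left and to the
right into a doubly infinite complex. -/
theorem exists_int_sequence {α : Type*} {S : α → Prop} {r : α → α → Prop}
    (hl : ∀ x, S x → ∃ y, S y ∧ r y x) (hr : ∀ x, S x → ∃ y, S y ∧ r x y) {x : α} (hx : S x) :
    ∃ z : ℤ → α, z 0 = x ∧ ∀ i, r (z (i + 1)) (z i) := by
  have hl' : ∀ x : {x // S x}, ∃ y : {y // S y}, r y x := fun x =>
    let ⟨y, hy, h⟩ := hl x x.2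
    ⟨⟨y, hy⟩, h⟩
  have hr' : ∀ x : {x // S x}, ∃ y : {y // S y}, r x y := fun x =>
    let ⟨y, hy, h⟩ := hr x x.2
    ⟨⟨y, hy⟩, h⟩
  choose a ha using hl'
  choose b hb using hr'
  let z : ℤ → {x // S x} := fun i => match i with
    | Int.ofNat k => a^[k] ⟨x, hx⟩
    | Int.negSucc k => b^[k + 1] ⟨x, hx⟩
  refine ⟨fun i => z i, rfl, fun i => ?_⟩
  rcases i with k | k | k
  · change r (a^[k + 1] ⟨x, hx⟩) (a^[k] ⟨x, hx⟩)
    rw [Function.iterate_succ_apply']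
    exact ha _
  · exact hb ⟨x, hx⟩
  · change r (b^[k + 1] ⟨x, hx⟩) (b^[k + 1 + 1] ⟨x, hx⟩)
    rw [Function.iterate_succ_apply' _ (k + 1)]
    exact hb _

end Splicing

/-! ### Hom-exactness by dimension shifting, and cosyzygies -/

section Injective

variable {R : Type u} [Ring R]

/-- With C_i the cokernels of the complex, Ext^{k+1}(A, C_i) embeds in Ext^{k+2}(A, C_{i+1}), as the
terms are injective. Iterating passes the projective dimension of A, so Ext¹(A, C_i) = 0 for all i
and maps into cokernels lift. -/
theorem homExactFrom_of_hasProjectiveDimensionLT {I : ChainComplex (ModuleCat.{u} R) ℤ}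
    (hI : I.Acyclic) (hinj : ∀ i, Injective (I.X i)) {A : ModuleCat.{u} R} {m : ℕ}
    (hA : HasProjectiveDimensionLT A m) : HomExactFrom A I := by
  have key : ∀ (t k : ℕ), m ≤ k + 1 + t → ∀ i : ℤ,
      Subsingleton (Abelian.Ext A (cokernel (I.d (i + 1) i)) (k + 1)) := by
    intro t
    induction t with
    | zero => exact fun k hk i => HasProjectiveDimensionLT.subsingleton A m _ hk _
    | succ t ih =>
      exact fun k hk i => (isSES_cokernel_d hI i).ext_right_of_succ (ih (k + 1) (by lia) _)
        (Abelian.Ext.subsingleton_of_injective _ _ _)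
  exact .of_exists_lift hI fun i φ =>
    (isSES_cokernel_d hI i).exists_lift_of_ext_one (key m 0 (by lia) _) φ

theorem homExactInto_of_hasInjectiveDimensionLT {P : ChainComplex (ModuleCat.{u} R) ℤ}
    (hP : P.Acyclic) (hproj : ∀ i, Projective (P.X i)) {L : ModuleCat.{u} R} {m : ℕ}
    (hL : HasInjectiveDimensionLT L m) : HomExactInto P L := by
  have key : ∀ (t k : ℕ), m ≤ k + 1 + t → ∀ i : ℤ,
      Subsingleton (Abelian.Ext (cokernel (P.d (i + 1) i)) L (k + 1)) := by
    intro t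
    induction t with
    | zero => exact fun k hk i => HasInjectiveDimensionLT.subsingleton L m _ hk _
    | succ t ih =>
      intro k hk i
      obtain ⟨j, rfl⟩ : ∃ j, i = j + 1 := ⟨i - 1, by ring⟩
      exact (isSES_cokernel_d hP j).ext_left_of_succ (ih (k + 1) (by lia) _)
        (Abelian.Ext.subsingleton_of_projective _ _ _)
  exact .of_exists_extend fun i φ =>
    (isSES_cokernel_d hP i).exists_extend_of_ext_one (key m 0 (by lia) _) φ

/-- There is an exact sequence `0 → M → I^0 → ⋯ → I^{n-1} → X → 0` with all `I^i` injective. -/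
def IsCosyzygy : ℕ → ModuleCat.{u} R → ModuleCat.{u} R → Prop
  | 0, M, X => Nonempty (M ≅ X)
  | n + 1, M, X => ∃ (I C : ModuleCat.{u} R) (f : M ⟶ I) (g : I ⟶ C),
      IsSES f g ∧ Injective I ∧ IsCosyzygy n C X

theorem exists_isCosyzygy (n : ℕ) (M : ModuleCat.{u} R) : ∃ X, IsCosyzygy n M X := by
  induction n generalizing M with
  | zero => exact ⟨M, ⟨Iso.refl M⟩⟩
  | succ n ih =>
    obtain ⟨I, C, f, g, hI, h⟩ := exists_injective_isSES M
    obtain ⟨X, hX⟩ := ih C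
    exact ⟨X, I, C, f, g, h, hI, hX⟩

/-- The recursion in `IsCosyzygy` adds terms next to M, whereas this adds one next to X. -/
theorem IsCosyzygy.succ {n : ℕ} {M X I C : ModuleCat.{u} R} (h : IsCosyzygy n M X) {f : X ⟶ I}
    {g : I ⟶ C} (hfg : IsSES f g) (hI : Injective I) : IsCosyzygy (n + 1) M C := by
  induction n generalizing M with
  | zero =>
    obtain ⟨e⟩ := h
    exact ⟨I, C, _, g, hfg.iso_left e, hI, ⟨Iso.refl C⟩⟩
  | succ n ih =>
    obtain ⟨J, D, a, b, hab, hJ, hD⟩ := h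
    exact ⟨J, D, a, b, hab, hJ, ih hD⟩

/-- The coresolution of C is prescribed and that of A is arbitrary. Iterating the horseshoe lemma
gives one of B between them. -/
theorem IsCosyzygy.exists_isSES {n : ℕ} {A B C X : ModuleCat.{u} R} {f : A ⟶ B} {g : B ⟶ C}
    (h : IsSES f g) (hC : IsCosyzygy n C X) :
    ∃ (Y Z : ModuleCat.{u} R) (f' : Y ⟶ Z) (g' : Z ⟶ X),
      IsSES f' g' ∧ IsCosyzygy n A Y ∧ IsCosyzygy n B Z := by
  induction n generalizing A B C with
  | zero =>
    obtain ⟨e⟩ := hC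
    exact ⟨A, B, f, _, h.iso_right e, ⟨Iso.refl A⟩, ⟨Iso.refl B⟩⟩
  | succ n ih =>
    obtain ⟨J, C', c, c', hc, hJ, hC'⟩ := hC
    obtain ⟨I, A', a, a', hI, ha⟩ := exists_injective_isSES A
    have := h.shortExact.mono_f
    obtain ⟨B', b, b', f', g', hb, hfg'⟩ := exists_horseshoe h ha hc
      (e := Injective.factorThru a f) (Injective.comp_factorThru a f)
    obtain ⟨Y, Z, f'', g'', h'', hY, hZ⟩ := ih hfg' hC'
    exact ⟨Y, Z, f'', g'', h'', ⟨I, A', a, a', ha, hI, hY⟩, I ⊞ J, B', b, b', hb,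
      inferInstance, hZ⟩

theorem IsCosyzygy.injective {n : ℕ} {M X : ModuleCat.{u} R} (h : IsCosyzygy n M X)
    (hM : HasInjectiveDimensionLE M n) : Injective X := by
  induction n generalizing M with
  | zero =>
    obtain ⟨e⟩ := h
    have : Injective M := injective_iff_hasInjectiveDimensionLT_one.2 hM
    exact Injective.of_iso e this
  | succ n ih =>
    obtain ⟨I, C, f, g, hfg, hI, hC⟩ := h
    exact ih hC (hfg.shortExact.hasInjectiveDimensionLT_X₃ (n + 1)
      (hasInjectiveDimensionLT_of_ge I 1 _ (by lia)) hM)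

theorem isZero_punit : IsZero (ModuleCat.of R PUnit.{u + 1}) :=
  ModuleCat.isZero_of_subsingleton _

theorem isSES_of_isZero_left {Z M : ModuleCat.{u} R} (hZ : IsZero Z) :
    IsSES (0 : Z ⟶ M) (𝟙 M) := by
  have : Subsingleton Z := ModuleCat.subsingleton_of_isZero hZ
  refine ⟨Function.injective_of_subsingleton _, fun x => ⟨fun hx => ⟨0, ?_⟩, ?_⟩,
    Function.surjective_id⟩
  · exact hx.symm
  · rintro ⟨y, rfl⟩
    rfl

theorem isSES_of_isZero_right {Z M : ModuleCat.{u} R} (hZ : IsZero Z) :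
    IsSES (𝟙 M) (0 : M ⟶ Z) := by
  have : Subsingleton Z := ModuleCat.subsingleton_of_isZero hZ
  exact ⟨Function.injective_id, fun x => ⟨fun _ => ⟨x, rfl⟩, fun _ => rfl⟩,
    fun y => ⟨0, Subsingleton.elim _ _⟩⟩

/-- If projective modules have injective dimension at most `n`, then injective modules and `n`-th
cosyzygies are cokernels in exact complexes of injective modules. -/
theorem exists_injective_complex {n : ℕ}
    (hP : ∀ P : ModuleCat.{u} R, Projective P → HasInjectiveDimensionLE P n)
    {X : ModuleCat.{u} R} (hX : Injective X ∨ ∃ M, IsCosyzygy n M X) :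
    ∃ I : ChainComplex (ModuleCat.{u} R) ℤ, (∀ i, Injective (I.X i)) ∧ I.Acyclic ∧
      Nonempty (X ≅ cokernel (I.d 1 0)) := by
  have h0 : Injective (ModuleCat.of R PUnit.{u + 1}) := isZero_punit.injective
  obtain ⟨Z, hZ0, hZ⟩ := exists_int_sequence
    (S := fun X : ModuleCat.{u} R => Injective X ∨ ∃ M, IsCosyzygy n M X)
    (r := fun Y X => ∃ (I : ModuleCat.{u} R) (f : Y ⟶ I) (g : I ⟶ X), Injective I ∧ IsSES f g)
    (by
      rintro X (hX | ⟨M, hX⟩)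
      · exact ⟨_, .inl h0, X, 0, 𝟙 X, hX, isSES_of_isZero_left isZero_punit⟩
      -- Extend to the left: cosyzygies of 0 → K → P → M → 0 give 0 → Y → E → X → 0 with Y an n-th
      -- cosyzygy of K. Here E is injective, being an n-th cosyzygy of a projective.
      · obtain ⟨K, P, f, g, hPr, hfg⟩ := exists_projective_isSES M
        obtain ⟨Y, E, f', g', hfg', hY, hE⟩ := IsCosyzygy.exists_isSES hfg hX
        exact ⟨Y, .inr ⟨K, hY⟩, E, f', g', hE.injective (hP P hPr), hfg'⟩)
    (by
      rintro X (hX | ⟨M, hX⟩)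
      · exact ⟨_, .inl h0, X, 𝟙 X, 0, hX, isSES_of_isZero_right isZero_punit⟩
      · obtain ⟨I, C, f, g, hI, hfg⟩ := exists_injective_isSES X
        -- An (n + 1)-st cosyzygy of M is an n-th cosyzygy of D, the first cosyzygy of M.
        obtain ⟨-, D, -, -, -, -, hD⟩ := hX.succ hfg hI
        exact ⟨C, .inr ⟨D, hD⟩, I, f, g, hI, hfg⟩) hX
  choose E ι π hE hs using hZ
  refine ⟨spliceChain hs, hE, fun i => ?_, ?_⟩
  · obtain ⟨j, rfl⟩ : ∃ j, i = j + 1 := ⟨i - 1, by ring⟩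
    exact spliceChain_exactAt hs j
  · obtain ⟨e⟩ := nonempty_cokernel_spliceChain_iso hs 0
    rw [zero_add, hZ0] at e
    exact ⟨e.symm⟩

theorem hasRightResolution_of_isCosyzygy {𝓧 : ModuleCat.{u} R → Prop}
    (h𝓧 : ∀ {M N : ModuleCat.{u} R}, (M ≅ N) → 𝓧 M → 𝓧 N) (hinj : ∀ I, Injective I → 𝓧 I)
    {n : ℕ} {M X : ModuleCat.{u} R} (h : IsCosyzygy n M X) (hX : 𝓧 X) :
    HasRightResolution 𝓧 n M := by
  let r : ModuleCat.{u} R → ModuleCat.{u} R → ModuleCat.{u} R → Prop := fun A B C =>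
    ∃ (f : A ⟶ B) (g : B ⟶ C), IsSES f g
  -- The pair `z i` is (G^i, Z^i), where 0 → Z^i → G^i → Z^{i+1} → 0 and Z^0 = M.
  obtain ⟨z, hz0, hz, hz1, hz2⟩ : ∃ z : ℕ → ModuleCat.{u} R × ModuleCat.{u} R, (z 0).2 = M ∧
      (∀ i, r (z i).2 (z i).1 (z (i + 1)).2) ∧ (∀ i ≤ n, 𝓧 (z i).1) ∧
      ∀ i > n, IsZero (z i).1 := by
    induction n generalizing M with
    | zero =>
      obtain ⟨e⟩ := h
      refine ⟨fun i => match i with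
        | 0 => (M, M)
        | _ + 1 => (ModuleCat.of R PUnit, ModuleCat.of R PUnit), rfl, ?_, ?_, ?_⟩
      · rintro (_ | i)
        · exact ⟨𝟙 M, 0, isSES_of_isZero_right isZero_punit⟩
        · exact ⟨0, 𝟙 _, isSES_of_isZero_left isZero_punit⟩
      · rintro (_ | i) hi
        · exact h𝓧 e.symm hX
        · lia
      · rintro (_ | i) hi
        · lia
        · exact isZero_punit
    | succ n ih =>
      obtain ⟨I, C, f, g, hfg, hI, hC⟩ := h
      obtain ⟨z, rfl, hz, hz1, hz2⟩ := ih hC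
      refine ⟨fun i => match i with
        | 0 => (I, M)
        | i + 1 => z i, rfl, ?_, ?_, ?_⟩
      · rintro (_ | i)
        · exact ⟨f, g, hfg⟩
        · exact hz i
      · rintro (_ | i) hi
        · exact hinj I hI
        · exact hz1 i (by lia)
      · rintro (_ | i) hi
        · lia
        · exact hz2 i (by lia)
  subst hz0
  -- Prepending (M, 0) moves M to degree 0 and G^i to degree i + 1.
  let y : ℕ → ModuleCat.{u} R × ModuleCat.{u} R := fun i => match i with
    | 0 => ((z 0).2, ModuleCat.of R PUnit)
    | i + 1 => z i
  have hy : ∀ i, r (y i).2 (y i).1 (y (i + 1)).2 := by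
    rintro (_ | i)
    · exact ⟨0, 𝟙 _, isSES_of_isZero_left isZero_punit⟩
    · exact hz i
  choose ι π hs using hy
  let d : ∀ i, (y i).1 ⟶ (y (i + 1)).1 := fun i => π i ≫ ι (i + 1)
  let K : CochainComplex (ModuleCat.{u} R) ℕ := CochainComplex.of (fun i => (y i).1) d
    fun i => splice_comp_eq_zero (hs (i + 1))
  have hd : ∀ i, K.d i (i + 1) = π i ≫ ι (i + 1) :=
    fun i => CochainComplex.of_d _ d i
  refine ⟨K, ?_, ⟨Iso.refl _⟩, hz1, hz2⟩
  rintro (_ | i)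
  · rw [K.exactAt_iff' 0 0 1 (by simp) (by simp)]
    refine (ShortComplex.exact_iff_mono _ (K.shape 0 0 (by simp))).2
      ((ModuleCat.mono_iff_injective _).2 ?_)
    change Function.Injective (K.d 0 (0 + 1)).hom
    rw [hd 0]
    refine (hs (0 + 1)).inj.comp ((injective_iff_map_eq_zero _).2 fun x hx => ?_)
    obtain ⟨t, rfl⟩ := ((hs 0).exact x).1 hx
    have : t = 0 := Subsingleton.elim (α := PUnit) _ _
    rw [this, map_zero]
  · rw [K.exactAt_iff' i (i + 1) (i + 1 + 1) (ComplexShape.prev_eq' _ rfl)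
      (ComplexShape.next_eq' _ rfl)]
    have := exact_splice (hs i).surj (hs (i + 1)) (hs (i + 1 + 1)).inj
      (splice_comp_eq_zero (hs (i + 1)))
    convert this using 1
    dsimp only [HomologicalComplex.sc', HomologicalComplex.shortComplexFunctor']
    congr 1 <;> exact hd _

end Injective

/-! ### Lifting along filtrations and Auslander's lemma -/

section Lifting

variable {R : Type u} [Ring R]

/-- Lifting problems against `p` can be solved along a well-ordered filtration. -/
theorem exists_lift_of_filtration {ι : Type*} [LinearOrder ι] [WellFoundedLT ι] {E I Y : Type*}
    [AddCommGroup E] [Module R E] [AddCommGroup I] [Module R I] [AddCommGroup Y] [Module R Y]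
    {N : ι → Submodule R E} (hN : Monotone N) (p : I →ₗ[R] Y)
    (h : ∀ i (f : N i →ₗ[R] Y) (g : ↥(⨆ j, ⨆ _ : j < i, N j) →ₗ[R] I),
      (∀ x (hx : x ∈ N i) (hx' : x ∈ ⨆ j, ⨆ _ : j < i, N j), p (g ⟨x, hx'⟩) = f ⟨x, hx⟩) →
      ∃ g' : N i →ₗ[R] I, (∀ x, p (g' x) = f x) ∧
        ∀ x (hx : x ∈ N i) (hx' : x ∈ ⨆ j, ⨆ _ : j < i, N j), g' ⟨x, hx⟩ = g ⟨x, hx'⟩)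
    (f : ↥(⨆ i, N i) →ₗ[R] Y) : ∃ g : ↥(⨆ i, N i) →ₗ[R] I, ∀ x, p (g x) = f x := by
  -- Partial lifts are only allowed on domains that are sums of members of the filtration. This pins
  -- down a maximal domain at the first N i it misses.
  let S : Set (E →ₗ.[R] I) := {g | (∀ x : g.domain, ∃ hx : (x : E) ∈ ⨆ i, N i,
    p (g x) = f ⟨x, hx⟩) ∧ g.domain ≤ ⨆ j, ⨆ _ : N j ≤ g.domain, N j}
  obtain ⟨g, -, hg⟩ := zorn_le_nonempty₀ S (fun c hc hchain y hy => by
    have hd : DirectedOn (· ≤ ·) c := hchain.directedOn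
    refine ⟨LinearPMap.sSup c hd, ⟨fun x => ?_, fun x hx => ?_⟩,
      fun z hz => LinearPMap.le_sSup hd hz⟩
    · obtain ⟨l, hl, hxl⟩ := (LinearPMap.mem_domain_sSup_iff ⟨y, hy⟩ hd).1 x.2
      obtain ⟨hx, hx'⟩ := (hc hl).1 ⟨x, hxl⟩
      exact ⟨hx, by rw [← hx', ← LinearPMap.sSup_apply hd hl ⟨x, hxl⟩]⟩
    · obtain ⟨l, hl, hxl⟩ := (LinearPMap.mem_domain_sSup_iff ⟨y, hy⟩ hd).1 hx
      have hle : (⨆ j, ⨆ _ : N j ≤ l.domain, N j) ≤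
          ⨆ j, ⨆ _ : N j ≤ (LinearPMap.sSup c hd).domain, N j :=
        iSup_mono fun j => iSup_mono' fun hj =>
          ⟨hj.trans (LinearPMap.le_sSup hd hl).1, le_rfl⟩
      exact hle ((hc hl).2 hxl))
    ⊥ ⟨fun x => by
      have hx : x = 0 := Subtype.ext ((Submodule.mem_bot R).1 x.2)
      subst hx
      refine ⟨zero_mem _, ?_⟩
      rw [LinearPMap.map_zero, map_zero]
      exact (map_zero f).symm, bot_le⟩
  have key : ∀ i, N i ≤ g.domain := by
    intro i
    induction i using WellFoundedLT.induction with
    | ind i ih =>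
    by_contra hi
    have h1 : (⨆ j, ⨆ _ : j < i, N j) ≤ g.domain := iSup₂_le ih
    -- An N j inside the domain must have j < i, since otherwise monotonicity would put N i inside
    -- it as well.
    have h2 : g.domain ≤ ⨆ j, ⨆ _ : j < i, N j :=
      hg.prop.2.trans (iSup_mono fun j => iSup_mono' fun hj =>
        ⟨lt_of_not_ge fun hij => hi ((hN hij).trans hj), le_rfl⟩)
    obtain ⟨g', hg', hgg⟩ := h i (f ∘ₗ Submodule.inclusion (le_iSup N i))
      (g.toFun ∘ₗ Submodule.inclusion h1) (fun x hx hx' => (hg.prop.1 ⟨x, h1 hx'⟩).2)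
    have hle : g.domain ≤ N i := h2.trans (iSup₂_le fun j hj => hN hj.le)
    refine hi (hg.le_of_ge (y := ⟨N i, g'⟩) ⟨fun x => ⟨le_iSup N i x.2, hg' x⟩,
      le_iSup₂_of_le (f := fun j (_ : N j ≤ N i) => N j) i le_rfl le_rfl⟩ ⟨hle, ?_⟩).1
    rintro ⟨x, hx⟩ ⟨y, hy⟩ hxy
    obtain rfl : x = y := hxy
    exact (hgg x hy (h2 hx)).symm
  refine ⟨g.toFun ∘ₗ Submodule.inclusion (iSup_le key), fun x => ?_⟩
  exact (hg.prop.1 ⟨x, iSup_le key x.2⟩).2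

theorem IsCosyzygy.ext_one_iff {n : ℕ} {M Z X : ModuleCat.{u} R} (h : IsCosyzygy n Z X) :
    Subsingleton (Abelian.Ext M X 1) ↔ Subsingleton (Abelian.Ext M Z (n + 1)) := by
  induction n generalizing Z with
  | zero =>
    obtain ⟨e⟩ := h
    exact (((Abelian.extFunctorObj M 1).mapIso e).addCommGroupIsoToAddEquiv).symm.subsingleton_congr
  | succ n ih =>
    obtain ⟨I, C, f, g, hfg, hI, hC⟩ := h
    rw [ih hC]
    exact ⟨fun h => hfg.ext_right_succ h (Abelian.Ext.subsingleton_of_injective _ _ _),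
      fun h => hfg.ext_right_of_succ h (Abelian.Ext.subsingleton_of_injective _ _ _)⟩

/-- Ext^{n+1}(M, Z) vanishes exactly when Ext¹(M, X) does, and I is injective, so the latter is the
obstruction to lifting maps M → Y to I. This turns a dimension bound into a lifting problem. -/
theorem hasProjectiveDimensionLE_of_exists_lift {n : ℕ} {M : ModuleCat.{u} R}
    (h : ∀ (Z X I Y : ModuleCat.{u} R) (f : X ⟶ I) (g : I ⟶ Y), IsCosyzygy n Z X → Injective I →
      IsSES f g → ∀ φ : M ⟶ Y, ∃ ψ : M ⟶ I, ψ ≫ g = φ) : HasProjectiveDimensionLE M n := by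
  refine hasProjectiveDimensionLT_of_enoughInjectives M _ fun Z => ?_
  obtain ⟨X, hX⟩ := exists_isCosyzygy n Z
  obtain ⟨I, Y, f, g, hI, hfg⟩ := exists_injective_isSES X
  rw [← hX.ext_one_iff]
  exact hfg.ext_one_of_exists_lift (h Z X I Y f g hX hI hfg)

/-- Auslander's lemma on the projective dimension of a filtered module. -/
theorem hasProjectiveDimensionLE_of_filtration {ι : Type*} [LinearOrder ι] [WellFoundedLT ι]
    {E : Type u} [AddCommGroup E] [Module R E] {N : ι → Submodule R E} (hN : Monotone N) {n : ℕ}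
    (h : ∀ i, HasProjectiveDimensionLE
      (ModuleCat.of R (N i ⧸ (⨆ j, ⨆ _ : j < i, N j).submoduleOf (N i))) n) :
    HasProjectiveDimensionLE (ModuleCat.of R ↥(⨆ i, N i)) n := by
  refine hasProjectiveDimensionLE_of_exists_lift fun Z X I Y a b hX hI hab φ => ?_
  suffices ∃ ψ : ↥(⨆ i, N i) →ₗ[R] I, ∀ x, b.hom (ψ x) = φ.hom x by
    obtain ⟨ψ, hψ⟩ := this
    exact ⟨ModuleCat.ofHom ψ, by ext x; exact hψ x⟩
  refine exists_lift_of_filtration hN b.hom (fun i f g hfg => ?_) φ.hom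
  let A := (⨆ j, ⨆ _ : j < i, N j).submoduleOf (N i)
  have hle : (⨆ j, ⨆ _ : j < i, N j) ≤ N i := iSup₂_le fun j hj => hN hj.le
  have hA := isSES_subtype_mkQ A
  have : Mono (ModuleCat.ofHom A.subtype) := hA.shortExact.mono_f
  let g₀ : ModuleCat.of R A ⟶ I :=
    ModuleCat.ofHom (g ∘ₗ (Submodule.submoduleOfEquivOfLe hle).toLinearMap)
  let g₁ := Injective.factorThru g₀ (ModuleCat.ofHom A.subtype)
  have hg₁ : ∀ x (hx : x ∈ N i) (hx' : x ∈ ⨆ j, ⨆ _ : j < i, N j),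
      g₁.hom ⟨x, hx⟩ = g ⟨x, hx'⟩ := fun x hx hx' =>
    ConcreteCategory.congr_hom (Injective.comp_factorThru g₀ (ModuleCat.ofHom A.subtype))
      ⟨⟨x, hx⟩, hx'⟩
  -- The error f - b g₁ vanishes on A, so it descends to the subquotient. There it lifts because
  -- Ext¹ into X vanishes, and the lift corrects g₁ without changing it on A.
  obtain ⟨t, ht⟩ := exists_comp_eq_of_surjective A.mkQ_surjective (f - b.hom ∘ₗ g₁.hom)
    (fun x hx => by
      rw [Submodule.mkQ_apply, Submodule.Quotient.mk_eq_zero] at hx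
      rw [LinearMap.sub_apply, sub_eq_zero, ← hfg x x.2 hx]
      exact congrArg b.hom (hg₁ x x.2 hx).symm)
  obtain ⟨s, hs⟩ := hab.exists_lift_of_ext_one (hX.ext_one_iff.2
    (HasProjectiveDimensionLT.subsingleton _ (n + 1) _ le_rfl Z)) (ModuleCat.ofHom t)
  refine ⟨g₁.hom + s.hom ∘ₗ A.mkQ, fun x => ?_, fun x hx hx' => ?_⟩
  · have hsx : b.hom (s.hom (A.mkQ x)) = t (A.mkQ x) := ConcreteCategory.congr_hom hs (A.mkQ x)
    rw [LinearMap.add_apply, map_add, LinearMap.comp_apply, hsx, ht]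
    simp
  · have : A.mkQ ⟨x, hx⟩ = 0 := by
      rw [Submodule.mkQ_apply, Submodule.Quotient.mk_eq_zero]
      exact hx'
    rw [LinearMap.add_apply, LinearMap.comp_apply, this, map_zero, add_zero]
    exact hg₁ x hx hx'

end Lifting

/-! ### Local retractions and projectivity of countable unions -/

section LocalRetractions

variable {R : Type u} [Ring R] {E : Type u} [AddCommGroup E] [Module R E]

/-- A union of a chain of submodules that are fixed by endomorphisms of a projective module with
values in the next submodule is projective. -/
theorem projective_of_chain [Module.Projective R E] {M : Submodule R E} {N : ℕ → Submodule R E}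
    (hN : Monotone N) (hM : ⨆ k, N k = M) (θ : ℕ → E →ₗ[R] E) (hθ : ∀ k x, θ k x ∈ N (k + 1))
    (hfix : ∀ k, ∀ x ∈ N k, θ k x = x) : Module.Projective R M := by
  have hmem : ∀ x ∈ M, ∃ k, x ∈ N k := fun x hx => by
    rwa [← hM, Submodule.mem_iSup_of_directed _ hN.directed_le] at hx
  -- The splitting is x ↦ (s_j x)_j with s_0 = 1 and s_{j+1} = 1 - θ_j. It has finite support
  -- because θ_j fixes x for large j.
  let s : ℕ → E →ₗ[R] E := fun j => Nat.casesOn j LinearMap.id fun j => LinearMap.id - θ j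
  have hs : ∀ k, ∀ x ∈ N k, ∀ j, k < j → s j x = 0 := by
    rintro k x hx (_ | j) hj
    · lia
    · change x - θ j x = 0
      rw [hfix j x (hN (Nat.lt_succ_iff.1 hj) hx), sub_self]
  have hfin : ∀ x : M, (Function.support fun j => s j x).Finite := fun x => by
    obtain ⟨k, hk⟩ := hmem x x.2
    refine (Set.finite_Iic k).subset fun j hj => ?_
    by_contra hj'
    exact hj (hs k x hk j (not_le.1 hj'))
  let σ : M →ₗ[R] ℕ →₀ E :=
    { toFun := fun x => Finsupp.ofSupportFinite (fun j => s j x) (hfin x)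
      map_add' := fun x y => by ext j; exact map_add (s j) _ _
      map_smul' := fun r x => by ext j; exact map_smul (s j) _ _ }
  have hθM : ∀ j x, θ j x ∈ M := fun j x => hM ▸ Submodule.mem_iSup_of_mem (j + 1) (hθ j x)
  let π : (ℕ →₀ E) →ₗ[R] M := Finsupp.lsum ℕ fun j => (θ j).codRestrict M (hθM j)
  classical
  have : Module.Projective R (ℕ →₀ E) := .of_equiv (finsuppLequivDFinsupp R).symm
  refine Module.Projective.of_split σ π (LinearMap.ext fun x => Subtype.ext ?_)
  obtain ⟨k, hk⟩ := hmem x x.2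
  have h1 : ((π (σ x) : M) : E) = ∑ j ∈ Finset.range (k + 1), θ j (s j x) := by
    rw [Finsupp.lsum_apply, Finsupp.sum_of_support_subset (s := Finset.range (k + 1)),
      AddSubmonoidClass.coe_finsetSum]
    · rfl
    · intro j hj
      by_contra hj'
      exact (Finsupp.mem_support_iff.1 hj) (hs k x hk j (by simpa using hj'))
    · simp
  -- The element θ_j x lies in N (j + 1), which θ_{j+1} fixes. So the sum telescopes to θ_k x = x.
  have h2 : ∀ j, θ (j + 1) (s (j + 1) x) = θ (j + 1) x - θ j x := fun j => by
    change θ (j + 1) (x - θ j x) = _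
    rw [map_sub, hfix (j + 1) _ (hθ j x)]
  rw [LinearMap.comp_apply, h1, Finset.sum_range_succ', Finset.sum_congr rfl fun j _ => h2 j,
    Finset.sum_range_sub (fun j => θ j (x : E))]
  change θ k (x : E) - θ 0 x + θ 0 x = x
  rw [sub_add_cancel, hfix k x hk]

/-- Each finite subset of `A` is fixed by an endomorphism of `E` whose image is contained in a
finitely generated submodule of `A`. -/
def HasLocalRetractions (A : Submodule R E) : Prop :=
  ∀ F : Finset E, (F : Set E) ⊆ A → ∃ (θ : E →ₗ[R] E) (φ : Finset E), (φ : Set E) ⊆ A ∧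
    (∀ x, θ x ∈ Submodule.span R (φ : Set E)) ∧ ∀ x ∈ F, θ x = x

end LocalRetractions

/-! ### Closure of a set under a finitary operation -/

section Closure

variable {E : Type u} (φ : Finset E → Finset E)

/-- `T` contains `φ F` for every nonempty finite subset `F`. -/
def IsFinClosed (T : Set E) : Prop :=
  ∀ F : Finset E, F.Nonempty → (F : Set E) ⊆ T → (φ F : Set E) ⊆ T

/-- One step of the construction of the closure of a set. -/
def finClosureStep (S : Set E) : Set E :=
  S ∪ ⋃ F : {F : Finset S // F.Nonempty}, (φ (F.1.map (Function.Embedding.subtype _)) : Set E)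

/-- The smallest set containing `S` that is closed under `φ`. -/
def finClosure (S : Set E) : Set E :=
  ⋃ k : ℕ, (finClosureStep φ)^[k] S

variable {φ}

theorem subset_finClosure (S : Set E) : S ⊆ finClosure φ S :=
  Set.subset_iUnion (fun k : ℕ => (finClosureStep φ)^[k] S) 0

theorem isFinClosed_iUnion {ι : Type*} {T : ι → Set E} [Nonempty ι]
    (hd : Directed (· ⊆ ·) T) (h : ∀ i, ∀ F : Finset E, F.Nonempty → (F : Set E) ⊆ T i →
      (φ F : Set E) ⊆ ⋃ i, T i) : IsFinClosed φ (⋃ i, T i) := by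
  intro F hF hFT
  obtain ⟨i, hi⟩ := hd.exists_mem_subset_of_finset_subset_biUnion hFT
  exact h i F hF hi

theorem subset_finClosureStep {S : Set E} {F : Finset E} (hF : F.Nonempty) (hFS : (F : Set E) ⊆ S) :
    (φ F : Set E) ⊆ finClosureStep φ S := by
  classical
  have h : (F.subtype (· ∈ S)).map (Function.Embedding.subtype _) = F :=
    Finset.subtype_map_of_mem fun x hx => hFS hx
  have hne : (F.subtype (· ∈ S)).Nonempty := by
    rw [← Finset.map_nonempty (f := Function.Embedding.subtype _), h]
    exact hF
  refine Set.subset_union_of_subset_right ?_ _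
  refine Set.subset_iUnion_of_subset ⟨_, hne⟩ ?_
  rw [h]

theorem isFinClosed_finClosure (S : Set E) : IsFinClosed φ (finClosure φ S) := by
  have hmono : Monotone fun k : ℕ => (finClosureStep φ)^[k] S := monotone_nat_of_le_succ fun k => by
    rw [Function.iterate_succ_apply']
    exact Set.subset_union_left
  refine isFinClosed_iUnion hmono.directed_le fun k F hF hFk =>
    (subset_finClosureStep hF hFk).trans ?_
  have := Set.subset_iUnion (fun k : ℕ => (finClosureStep φ)^[k] S) (k + 1)
  rwa [Function.iterate_succ_apply'] at this

theorem finClosure_subset {S T : Set E} (hT : IsFinClosed φ T) (hST : S ⊆ T) :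
    finClosure φ S ⊆ T := by
  refine Set.iUnion_subset fun k => ?_
  induction k with
  | zero => exact hST
  | succ k ih =>
    rw [Function.iterate_succ_apply']
    refine Set.union_subset ih (Set.iUnion_subset fun F => hT _ (F.2.map) fun x hx => ?_)
    obtain ⟨y, -, rfl⟩ := Finset.mem_map.1 (Finset.mem_coe.1 hx)
    exact ih y.2

open Cardinal in
-- Each of the countably many steps adds a finite set for each finite subset. So closures of smaller
-- subsets of an uncountable set stay smaller.
theorem mk_finClosure_le (S : Set E) : #(finClosure φ S) ≤ max #S ℵ₀ := by
  have hfinset : ∀ (T : Set E), #(Finset T) ≤ max #T ℵ₀ := fun T => by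
    rcases finite_or_infinite T with h | h
    · exact le_max_of_le_right (mk_le_aleph0)
    · exact le_max_of_le_left (mk_finset_of_infinite T).le
  have hc : ℵ₀ ≤ max #S ℵ₀ := le_max_right _ _
  have hk : ∀ k : ℕ, #((finClosureStep φ)^[k] S : Set E) ≤ max #S ℵ₀ := by
    intro k
    induction k with
    | zero => exact le_max_left _ _
    | succ k ih =>
      rw [Function.iterate_succ_apply']
      refine (mk_union_le _ _).trans (add_le_of_le hc ih ?_)
      refine (mk_iUnion_le _).trans ?_
      refine mul_le_of_le hc ?_ ?_
      · exact (mk_subtype_le _).trans ((hfinset _).trans (max_le ih hc))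
      · exact ciSup_le' fun F => (mk_le_aleph0 (α := ↥(φ _))).trans hc
  have h := mk_iUnion_le_lift fun k : ℕ => (finClosureStep φ)^[k] S
  rw [lift_uzero] at h
  refine h.trans (mul_le_of_le hc ?_ (ciSup_le' fun k => ?_))
  · simp
  · rw [lift_uzero]
    exact hk k

end Closure

/-! ### Projective dimension by induction on cardinality -/

section Jensen

variable {R : Type u} [Ring R] {E : Type u} [AddCommGroup E] [Module R E]

theorem hasProjectiveDimensionLE_of_module_projective {M : Type u} [AddCommGroup M] [Module R M]
    [Module.Projective R M] (n : ℕ) : HasProjectiveDimensionLE (ModuleCat.of R M) n := by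
  have := (IsProjective.iff_projective (R := R) M).1 inferInstance
  exact hasProjectiveDimensionLT_of_ge _ 1 _ (by lia)

/-- The data of local retractions for the elements of a countable set produce a projective
module. -/
theorem projective_span_of_countable [Module.Projective R E] {T : Set E} (hT : T.Countable)
    (hT0 : T.Nonempty) {θ : Finset E → E →ₗ[R] E} {φ : Finset E → Finset E}
    (hφ : IsFinClosed φ T)
    (hθ : ∀ F : Finset E, (F : Set E) ⊆ T → ∀ x, θ F x ∈ Submodule.span R (φ F : Set E))
    (hfix : ∀ F : Finset E, (F : Set E) ⊆ T → ∀ x ∈ F, θ F x = x) :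
    Module.Projective R (Submodule.span R T) := by
  classical
  obtain ⟨t, rfl⟩ := hT.exists_eq_range hT0
  -- An exhaustion of T by finite sets, where F (k + 1) contains φ (F k) so that θ (F k) maps into
  -- the span of F (k + 1).
  obtain ⟨F, hF0, hF⟩ : ∃ F : ℕ → Finset E, F 0 = {t 0} ∧
      ∀ k, F (k + 1) = (F k ∪ φ (F k)) ∪ {t (k + 1)} :=
    ⟨fun k => Nat.rec ({t 0} : Finset E) (fun k F => (F ∪ φ F) ∪ {t (k + 1)}) k, rfl,
      fun _ => rfl⟩
  have hne : ∀ k : ℕ, (F k).Nonempty ∧ (F k : Set E) ⊆ Set.range t := by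
    intro k
    induction k with
    | zero => simp [hF0]
    | succ k ih =>
      rw [hF]
      refine ⟨Finset.Nonempty.inr (Finset.singleton_nonempty _), ?_⟩
      rw [Finset.coe_union, Finset.coe_union]
      exact Set.union_subset (Set.union_subset ih.2 (hφ _ ih.1 ih.2)) (by simp)
  have hmono : Monotone F := monotone_nat_of_le_succ fun k => by
    rw [hF, Finset.union_assoc]
    exact Finset.subset_union_left
  refine projective_of_chain (N := fun k => Submodule.span R (F k : Set E))
    (fun i j hij => Submodule.span_mono (Finset.coe_subset.2 (hmono hij))) ?_ (fun k => θ (F k))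
    (fun k x => ?_) (fun k x hx => ?_)
  · rw [← Submodule.span_iUnion]
    congr 1
    refine (Set.iUnion_subset fun k => (hne k).2).antisymm ?_
    rintro _ ⟨k, rfl⟩
    refine Set.mem_iUnion.2 ⟨k, ?_⟩
    cases k with
    | zero => simp [hF0]
    | succ k => rw [hF]; simp
  · refine Submodule.span_mono ?_ (hθ _ (hne k).2 x)
    rw [hF, Finset.coe_union, Finset.coe_union]
    exact Set.subset_union_right.trans Set.subset_union_left
  · have : Submodule.span R (F k : Set E) ≤ LinearMap.eqLocus (θ (F k)) LinearMap.id :=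
      Submodule.span_le.2 fun y hy => hfix _ (hne k).2 y hy
    exact this hx

open Cardinal in
/-- If modules of finite projective dimension have projective dimension at most `n`, then so do
the submodules of projective modules that have local retractions. -/
theorem HasLocalRetractions.hasProjectiveDimensionLE [Module.Projective R E] {n : ℕ}
    (hfin : ∀ (M : ModuleCat.{u} R) (m : ℕ), HasProjectiveDimensionLT M m →
      HasProjectiveDimensionLE M n) {A : Submodule R E} (hA : HasLocalRetractions A) :
    HasProjectiveDimensionLE (ModuleCat.of R A) n := by
  choose! θ φ hφA hθ hfix using hA
  -- The induction runs over closed generating sets, not submodules: spans of smaller closed sets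
  -- inherit the retractions without being pure themselves by fiat.
  suffices ∀ (c : Cardinal.{u}) (T : Set E), #T = c → T ⊆ A → IsFinClosed φ T →
      HasProjectiveDimensionLE (ModuleCat.of R (Submodule.span R T)) n by
    have h := this _ A rfl subset_rfl fun F _ hF => hφA F hF
    rwa [Submodule.span_eq] at h
  intro c
  induction c using WellFoundedLT.induction with
  | ind c ih =>
  intro T hTc hTA hT
  rcases T.eq_empty_or_nonempty with rfl | hT0
  · rw [Submodule.span_empty]
    exact hasProjectiveDimensionLE_of_module_projective n
  rcases le_or_gt c ℵ₀ with hc | hc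
  · have := projective_span_of_countable (le_aleph0_iff_set_countable.1 (hTc.trans_le hc)) hT0 hT
      (fun F hF => hθ F (hF.trans hTA)) (fun F hF => hfix F (hF.trans hTA))
    exact hasProjectiveDimensionLE_of_module_projective n
  -- Indexing T by the initial ordinal of c makes all proper initial segments smaller than c, so the
  -- induction hypothesis applies to their closures.
  obtain ⟨e⟩ : Nonempty (c.ord.ToType ≃ T) := Cardinal.eq.1 (by rw [mk_ord_toType, hTc])
  let t : c.ord.ToType → E := fun i => e i
  let C : c.ord.ToType → Set E := fun i => finClosure φ (t '' Set.Iic i)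
  have htT : ∀ s : Set c.ord.ToType, t '' s ⊆ T := fun s => by
    rintro _ ⟨i, -, rfl⟩
    exact (e i).2
  have hsmall : ∀ s : Set c.ord.ToType, #s < c → HasProjectiveDimensionLE
      (ModuleCat.of R (Submodule.span R (finClosure φ (t '' s)))) n := fun s hs => by
    refine ih _ ?_ _ rfl ((finClosure_subset hT (htT s)).trans hTA) (isFinClosed_finClosure _)
    exact (mk_finClosure_le _).trans_lt (max_lt (mk_image_le.trans_lt hs) hc)
  have hIio : ∀ i : c.ord.ToType, #(Set.Iio i) < c := fun i => by
    have := mk_Iio_lt i (by rw [mk_ord_toType, Ordinal.type_toType])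
    rwa [mk_ord_toType] at this
  have hIic : ∀ i : c.ord.ToType, #(Set.Iic i) < c := fun i => by
    rw [← Set.Iio_insert]
    exact mk_insert_le.trans_lt (add_lt_of_lt hc.le (hIio i)
      (one_lt_aleph0.trans hc))
  have hCmono : Monotone C := fun i j hij => finClosure_subset (isFinClosed_finClosure _)
    ((Set.image_mono (Set.Iic_subset_Iic.2 hij)).trans (subset_finClosure _))
  let N : c.ord.ToType → Submodule R E := fun i => Submodule.span R (C i)
  have hN : Monotone N := fun i j hij => Submodule.span_mono (hCmono hij)
  have hsup : ⨆ i, N i = Submodule.span R T := by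
    rw [← Submodule.span_iUnion]
    congr 1
    refine (Set.iUnion_subset fun i => finClosure_subset hT (htT _)).antisymm fun x hx => ?_
    obtain ⟨i, hi⟩ := e.surjective ⟨x, hx⟩
    exact Set.mem_iUnion.2 ⟨i, subset_finClosure _ ⟨i, Set.self_mem_Iic, congrArg Subtype.val hi⟩⟩
  have hsup' : ∀ i, (⨆ j, ⨆ _ : j < i, N j) =
      Submodule.span R (finClosure φ (t '' Set.Iio i)) := fun i => by
    simp only [N, ← Submodule.span_iUnion]
    congr 1
    refine (Set.iUnion₂_subset fun j hj => finClosure_subset (isFinClosed_finClosure _)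
      ((Set.image_mono (Set.Iic_subset_Iio.2 hj)).trans
        (subset_finClosure _))).antisymm (finClosure_subset ?_ ?_)
    -- Here it matters that closedness concerns nonempty F only: for the least i the union is empty
    -- and need not contain φ ∅.
    · intro F hF hFs
      have : Nonempty {j // j < i} := by
        obtain ⟨x, hx⟩ := hF
        obtain ⟨j, hj, -⟩ := Set.mem_iUnion₂.1 (hFs hx)
        exact ⟨⟨j, hj⟩⟩
      have hd : Directed (· ⊆ ·) fun j : {j // j < i} => C j :=
        Monotone.directed_le fun j k hjk => hCmono hjk
      obtain ⟨j, hj⟩ := hd.exists_mem_subset_of_finset_subset_biUnion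
        (hFs.trans (Set.iUnion₂_subset fun j hj =>
          Set.subset_iUnion (fun j : {j // j < i} => C j) ⟨j, hj⟩))
      exact (isFinClosed_finClosure _ F hF hj).trans
        (Set.subset_iUnion₂ (s := fun j (_ : j < i) => C j) j.1 j.2)
    · rintro _ ⟨j, hj, rfl⟩
      exact Set.mem_iUnion₂.2 ⟨j, hj, subset_finClosure _ ⟨j, Set.self_mem_Iic, rfl⟩⟩
  rw [← hsup]
  -- A quotient of two modules of dimension at most n has dimension at most n + 1, and `hfin` brings
  -- it back to n.
  refine hasProjectiveDimensionLE_of_filtration hN fun i => hfin _ (n + 2) ?_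
  have hle : (⨆ j, ⨆ _ : j < i, N j) ≤ N i := iSup₂_le fun j hj => hN hj.le
  refine (isSES_subtype_mkQ _).shortExact.hasProjectiveDimensionLT_X₃ (n + 1) ?_
    (have := hsmall _ (hIic i); hasProjectiveDimensionLT_of_ge _ (n + 1) _ (by lia))
  have h1 : HasProjectiveDimensionLE (ModuleCat.of R ↥(⨆ j, ⨆ _ : j < i, N j)) n := by
    rw [hsup']
    exact hsmall _ (hIio i)
  exact hasProjectiveDimensionLT_of_iso
    (Submodule.submoduleOfEquivOfLe hle).symm.toModuleIso _

end Jensen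

/-! ### Pure submodules and their projective dimension -/

section Purity

variable {R : Type u} [Ring R]

/-- Every finite system of linear equations over `A` that is solvable in `E` is solvable
in `A`. -/
def IsPureSubmodule {E : Type u} [AddCommGroup E] [Module R E] (A : Submodule R E) : Prop :=
  ∀ (n : ℕ) (N : Submodule R (Fin n → R)), N.FG → ∀ x : (Fin n → R) →ₗ[R] E, (∀ v ∈ N, x v ∈ A) →
    ∃ y : (Fin n → R) →ₗ[R] E, (∀ v, y v ∈ A) ∧ ∀ v ∈ N, y v = x v

namespace IsPureSubmodule

variable {E : Type u} [AddCommGroup E] [Module R E] {A : Submodule R E}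

/-- A finitely generated N involves finitely many coordinates. Solving there and composing with the
projection also makes the image finitely generated. -/
theorem exists_finsupp (hA : IsPureSubmodule A) {X : Type*} {N : Submodule R (X →₀ R)}
    (hN : N.FG) (x : (X →₀ R) →ₗ[R] E) (hx : ∀ v ∈ N, x v ∈ A) :
    ∃ (y : (X →₀ R) →ₗ[R] E) (W : Submodule R E), W.FG ∧ W ≤ A ∧ (∀ v, y v ∈ W) ∧
      ∀ v ∈ N, y v = x v := by
  classical
  obtain ⟨F, rfl⟩ := hN
  let S : Finset X := F.biUnion Finsupp.support
  let e : Fin S.card ≃ S := S.equivFin.symm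
  let i : (Fin S.card → R) →ₗ[R] X →₀ R :=
    Fintype.linearCombination R fun k => Finsupp.single (e k : X) (1 : R)
  let p : (X →₀ R) →ₗ[R] Fin S.card → R := LinearMap.pi fun k => Finsupp.lapply (e k : X)
  have hip : ∀ v ∈ Submodule.span R (F : Set (X →₀ R)), i (p v) = v := by
    have : Submodule.span R (F : Set (X →₀ R)) ≤ LinearMap.eqLocus (i ∘ₗ p) LinearMap.id := by
      refine Submodule.span_le.2 fun v hv => ?_
      have hvS : v.support ⊆ S := Finset.subset_biUnion_of_mem Finsupp.support hv
      change i (p v) = v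
      have h1 : i (p v) = ∑ k, Finsupp.single (e k : X) (v (e k)) := by
        simp [i, p, Fintype.linearCombination_apply]
      rw [h1, e.sum_comp (fun s : S => Finsupp.single (s : X) (v s)),
        Finset.sum_coe_sort S (fun s => Finsupp.single s (v s)), ← Finsupp.sum_of_support_subset v
          hvS (fun s a => Finsupp.single s a) (by simp), Finsupp.sum_single]
    exact fun v hv => this hv
  obtain ⟨y, hyA, hy⟩ := hA _ ((Submodule.span R (F : Set (X →₀ R))).map p)
    (Submodule.FG.map p ⟨F, rfl⟩) (x ∘ₗ i) (by
      rintro _ ⟨v, hv, rfl⟩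
      rw [LinearMap.comp_apply, hip v hv]
      exact hx v hv)
  refine ⟨y ∘ₗ p, LinearMap.range y, ?_, ?_, fun v => ⟨p v, rfl⟩, fun v hv => ?_⟩
  · exact Module.Finite.fg_top.map y |> (Submodule.map_top y ▸ ·)
  · rintro _ ⟨v, rfl⟩
    exact hyA v
  · rw [LinearMap.comp_apply, hy _ ⟨v, hv, rfl⟩, LinearMap.comp_apply, hip v hv]

/-- Embed E in a free module by a section s of the canonical cover. Purity replaces the cover by a
map y into A that agrees with it on s(F), and y ∘ s is the retraction. -/
theorem hasLocalRetractions [Module.Projective R E] (hA : IsPureSubmodule A) :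
    HasLocalRetractions A := by
  intro F hF
  obtain ⟨s, hs⟩ := Module.projective_def'.1 (inferInstance : Module.Projective R E)
  have hs' : ∀ x, Finsupp.linearCombination R id (s x) = x := fun x => LinearMap.congr_fun hs x
  obtain ⟨y, W, ⟨φ, rfl⟩, hW, hyW, hy⟩ := hA.exists_finsupp
    (N := (Submodule.span R (F : Set E)).map s) (Submodule.FG.map s ⟨F, rfl⟩)
    (Finsupp.linearCombination R id) (by
      rintro _ ⟨v, hv, rfl⟩
      rw [hs']
      exact Submodule.span_le.2 hF hv)
  refine ⟨y ∘ₗ s, φ, Submodule.span_le.1 hW, fun x => hyW _, fun x hx => ?_⟩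
  rw [LinearMap.comp_apply, hy _ ⟨x, Submodule.subset_span hx, rfl⟩, hs']

end IsPureSubmodule

section Kernel

variable {A E P Q : Type u} [AddCommGroup A] [Module R A] [AddCommGroup E] [Module R E]
  [AddCommGroup P] [Module R P] [AddCommGroup Q] [Module R Q]

/-- The embedding of the kernel of `P → A` into the kernel of `P × Q → E`. -/
def kerInl (i : A →ₗ[R] E) (π : P →ₗ[R] A) (h : Q →ₗ[R] E) :
    LinearMap.ker π →ₗ[R] LinearMap.ker ((i ∘ₗ π).coprod h) :=
  (LinearMap.inl R P Q ∘ₗ (LinearMap.ker π).subtype).codRestrict _ fun x => by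
    have hx : π x = 0 := x.2
    change i (π x) + h 0 = 0
    rw [hx, map_zero, map_zero, add_zero]

theorem kerInl_injective (i : A →ₗ[R] E) (π : P →ₗ[R] A) (h : Q →ₗ[R] E) :
    Function.Injective (kerInl i π h) := fun _ _ hxy =>
  Subtype.ext (congrArg (fun z => z.1.1) hxy)

/-- If `A` is pure in `E`, then the kernel of `P → A` is pure in the kernel of
`P × R^(X) → E`. -/
theorem isPureSubmodule_range_kerInl {i : A →ₗ[R] E} (hi : Function.Injective i)
    (hA : IsPureSubmodule (LinearMap.range i)) {π : P →ₗ[R] A} (hπ : Function.Surjective π)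
    {X : Type u} (h : (X →₀ R) →ₗ[R] E) :
    IsPureSubmodule (E := LinearMap.ker ((i ∘ₗ π).coprod h)) (LinearMap.range (kerInl i π h)) := by
  intro n N hN x hx
  let x₁ : (Fin n → R) →ₗ[R] P := LinearMap.fst R P (X →₀ R) ∘ₗ Submodule.subtype _ ∘ₗ x
  let x₂ : (Fin n → R) →ₗ[R] X →₀ R := LinearMap.snd R P (X →₀ R) ∘ₗ Submodule.subtype _ ∘ₗ x
  have hx₁₂ : ∀ v, i (π (x₁ v)) + h (x₂ v) = 0 := fun v => (x v).2
  have hx₂ : ∀ v ∈ N, x₂ v = 0 := fun v hv => by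
    obtain ⟨z, hz⟩ := hx v hv
    exact congrArg (fun z => z.1.2) hz.symm
  obtain ⟨y, W, -, hW, hyW, hy⟩ := hA.exists_finsupp (N := LinearMap.range x₂)
    (Module.Finite.iff_fg.1 (Module.Finite.range x₂)) h (by
      rintro _ ⟨v, rfl⟩
      rw [eq_neg_of_add_eq_zero_right (hx₁₂ v), ← map_neg]
      exact ⟨_, rfl⟩)
  -- By purity y maps into A and agrees with h on the image of x₂. Lifting y to w : R^(X) → P makes
  -- x₁ + w x₂ land in ker π, and on N it equals x₁ because x₂ vanishes there.
  obtain ⟨w, hw⟩ := Module.projective_lifting_property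
    ((LinearEquiv.ofInjective i hi).toLinearMap ∘ₗ π)
    (y.codRestrict (LinearMap.range i) fun v => hW (hyW v))
    ((LinearEquiv.ofInjective i hi).surjective.comp hπ)
  have hw' : ∀ v, i (π (w v)) = y v := fun v => congrArg Subtype.val (LinearMap.congr_fun hw v)
  have hz : ∀ v, π ((x₁ + w ∘ₗ x₂) v) = 0 := fun v => hi (by
    change i (π (x₁ v + w (x₂ v))) = i 0
    rw [map_add, map_add, hw', hy _ ⟨v, rfl⟩, hx₁₂, map_zero])
  refine ⟨kerInl i π h ∘ₗ (x₁ + w ∘ₗ x₂).codRestrict (LinearMap.ker π) hz,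
    fun v => ⟨_, rfl⟩, fun v hv => Subtype.ext (Prod.ext ?_ (hx₂ v hv).symm)⟩
  change x₁ v + w (x₂ v) = x₁ v
  rw [hx₂ v hv, map_zero, add_zero]

end Kernel

theorem exists_finsupp_surjective (M : Type u) [AddCommGroup M] [Module R M] :
    ∃ π : (M →₀ R) →ₗ[R] M, Function.Surjective π :=
  ⟨Finsupp.linearCombination R id, fun a => ⟨Finsupp.single a 1, by simp⟩⟩

/-- A pure submodule of a module of finite projective dimension has projective dimension at most
`n`, if `n` bounds the projective dimensions that are finite. -/
theorem hasProjectiveDimensionLE_of_pure {n m : ℕ}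
    (hfin : ∀ (M : ModuleCat.{u} R) (m : ℕ), HasProjectiveDimensionLT M m →
      HasProjectiveDimensionLE M n) {A E : Type u} [AddCommGroup A] [Module R A]
    [AddCommGroup E] [Module R E] {i : A →ₗ[R] E} (hi : Function.Injective i)
    (hA : IsPureSubmodule (LinearMap.range i))
    (hE : HasProjectiveDimensionLE (ModuleCat.of R E) m) :
    HasProjectiveDimensionLE (ModuleCat.of R A) n := by
  induction m generalizing A E with
  | zero =>
    have : Projective (ModuleCat.of R E) := projective_iff_hasProjectiveDimensionLT_one.2 hE
    have : Module.Projective R E := (IsProjective.iff_projective E).2 this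
    have h := hA.hasLocalRetractions.hasProjectiveDimensionLE hfin
    exact hasProjectiveDimensionLT_of_iso (LinearEquiv.ofInjective i hi).symm.toModuleIso _
  | succ m ih =>
    -- Covering E by the free covers of A and of E together makes the kernel over A a pure submodule
    -- of the kernel over E, whose dimension is one less.
    obtain ⟨π, hπ⟩ := exists_finsupp_surjective (R := R) A
    obtain ⟨h, hh⟩ := exists_finsupp_surjective (R := R) E
    have hg : Function.Surjective ((i ∘ₗ π).coprod h) := fun a => by
      obtain ⟨b, rfl⟩ := hh a
      exact ⟨(0, b), by simp⟩
    have h1 : HasProjectiveDimensionLE (ModuleCat.of R (LinearMap.ker ((i ∘ₗ π).coprod h))) m :=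
      (isSES_ker hg).shortExact.hasProjectiveDimensionLT_X₁ (m + 1)
        (hasProjectiveDimensionLE_of_module_projective m) hE
    have h2 := ih (A := LinearMap.ker π) (kerInl_injective i π h)
      (isPureSubmodule_range_kerInl hi hA hπ h) h1
    exact hfin _ (n + 2) ((isSES_ker hπ).shortExact.hasProjectiveDimensionLT_X₃ (n + 1) h2
      (hasProjectiveDimensionLE_of_module_projective _))

end Purity

/-! ### Finite presentation and resolutions over coherent rings -/

section Coherent

variable {S : Type u} [Ring S] {B : Type u} [AddCommGroup B] [Module S B]

/-- Project to one coordinate: the image is a finitely generated submodule of B, hence finitely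
presented, so the kernel is finitely generated and embeds in a smaller power. The module B is kept
apart from S because right ideals are Rᵐᵒᵖ-submodules of R. -/
theorem finitePresentation_of_injective_pi
    (hB : ∀ I : Submodule S B, I.FG → Module.FinitePresentation S I) {n : ℕ} {M : Type u}
    [AddCommGroup M] [Module S M] [Module.Finite S M] (i : M →ₗ[S] (Fin n → B))
    (hi : Function.Injective i) : Module.FinitePresentation S M := by
  induction n generalizing M with
  | zero =>
    have : Subsingleton M := hi.subsingleton
    exact .of_subsingleton M
  | succ n ih =>
    let l : M →ₗ[S] B := LinearMap.proj 0 ∘ₗ i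
    have h1 : Module.FinitePresentation S (LinearMap.range l) :=
      hB _ (Module.Finite.iff_fg.1 (Module.Finite.range l))
    have h2 : (LinearMap.ker l.rangeRestrict).FG :=
      Module.FinitePresentation.fg_ker _ l.surjective_rangeRestrict
    have h3 : Module.Finite S (LinearMap.ker l.rangeRestrict) := Module.Finite.iff_fg.2 h2
    have h4 : Module.FinitePresentation S (LinearMap.ker l.rangeRestrict) :=
      ih (LinearMap.funLeft S B Fin.succ ∘ₗ i ∘ₗ Submodule.subtype _) fun x y hxy => by
        have h0 : ∀ z : LinearMap.ker l.rangeRestrict, i z 0 = 0 := fun z =>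
          congrArg Subtype.val (LinearMap.mem_ker.1 z.2)
        refine Subtype.ext (hi (funext (Fin.cases ?_ fun j => congrFun hxy j)))
        rw [h0, h0]
    exact Module.finitePresentation_of_ker l.rangeRestrict l.surjective_rangeRestrict

/-- Over a coherent ring, a finitely presented module has a finite free cover with finitely
presented kernel. -/
theorem exists_isSES_of_finitePresentation
    (hB : ∀ I : Submodule S B, I.FG → Module.FinitePresentation S I) (e : B ≃ₗ[S] S)
    (X : ModuleCat.{u} S) (hX : Module.FinitePresentation S X) :
    ∃ (K E : ModuleCat.{u} S) (f : K ⟶ E) (g : E ⟶ X), IsSES f g ∧ Projective E ∧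
      Module.Finite S E ∧ Module.FinitePresentation S K := by
  obtain ⟨n, -, f, -, hf, -⟩ := Module.FinitePresentation.exists_fin' S X
  have h1 : Module.Finite S (LinearMap.ker f) :=
    Module.Finite.iff_fg.2 (Module.FinitePresentation.fg_ker f hf)
  let e' : (Fin n → S) ≃ₗ[S] (Fin n → B) := LinearEquiv.piCongrRight fun _ => e.symm
  have h2 : Module.FinitePresentation S (LinearMap.ker f) :=
    finitePresentation_of_injective_pi hB (e'.toLinearMap ∘ₗ (LinearMap.ker f).subtype)
      (e'.injective.comp Subtype.val_injective)
  exact ⟨ModuleCat.of S (LinearMap.ker f), ModuleCat.of S (Fin n → S), _, _, isSES_ker hf,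
    (IsProjective.iff_projective (R := S) (Fin n → S)).1 inferInstance, inferInstance, h2⟩

theorem exists_finite_projective_sequence
    (hB : ∀ I : Submodule S B, I.FG → Module.FinitePresentation S I) (e : B ≃ₗ[S] S)
    (X : ModuleCat.{u} S) (hX : Module.FinitePresentation S X) :
    ∃ (E Z : ℕ → ModuleCat.{u} S) (ι : ∀ i, Z (i + 1) ⟶ E i) (π : ∀ i, E i ⟶ Z i),
      Nonempty (Z 0 ≅ X) ∧ (∀ i, IsSES (ι i) (π i)) ∧ (∀ i, Projective (E i)) ∧
        ∀ i, Module.Finite S (E i) := by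
  choose K E f g h hE hE' hK using exists_isSES_of_finitePresentation hB e
  let z : ℕ → {X : ModuleCat.{u} S // Module.FinitePresentation S X} := fun i =>
    Nat.rec ⟨X, hX⟩ (fun _ Y => ⟨K Y.1 Y.2, hK Y.1 Y.2⟩) i
  exact ⟨fun i => E (z i).1 (z i).2, fun i => (z i).1, fun i => f (z i).1 (z i).2,
    fun i => g (z i).1 (z i).2, ⟨Iso.refl X⟩, fun i => h _ _, fun i => hE _ _, fun i => hE' _ _⟩

theorem isTypeFPInfty_of_sequence {E Z : ℕ → ModuleCat.{u} S} {ι : ∀ i, Z (i + 1) ⟶ E i}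
    {π : ∀ i, E i ⟶ Z i} (h : ∀ i, IsSES (ι i) (π i)) (hE : ∀ i, Projective (E i))
    (hE' : ∀ i, Module.Finite S (E i)) : IsTypeFPInfty (Z 0) :=
  ⟨spliceResolution h hE, hE'⟩

end Coherent

/-! ### Absolutely clean modules over left coherent rings -/

section AbsolutelyClean

variable {R : Type u} [Ring R]

theorem isTypeFPInfty_quotient (hR : IsLeftCoherent R) {n : ℕ} {N : Submodule R (Fin n → R)}
    (hN : N.FG) : IsTypeFPInfty (ModuleCat.of R ((Fin n → R) ⧸ N)) := by
  have h1 : Module.Finite R N := Module.Finite.iff_fg.2 hN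
  obtain ⟨E, Z, ι, π, ⟨e⟩, h, hE, hE'⟩ := exists_finite_projective_sequence hR
    (LinearEquiv.refl R R) (ModuleCat.of R N)
    (finitePresentation_of_injective_pi hR N.subtype N.injective_subtype)
  let E' : ℕ → ModuleCat.{u} R := fun | 0 => ModuleCat.of R (Fin n → R) | i + 1 => E i
  let Z' : ℕ → ModuleCat.{u} R := fun | 0 => ModuleCat.of R ((Fin n → R) ⧸ N) | i + 1 => Z i
  let ι' : ∀ i, Z' (i + 1) ⟶ E' i := fun
    | 0 => e.hom ≫ ModuleCat.ofHom N.subtype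
    | i + 1 => ι i
  let π' : ∀ i, E' i ⟶ Z' i := fun | 0 => ModuleCat.ofHom N.mkQ | i + 1 => π i
  refine isTypeFPInfty_of_sequence (Z := Z') (E := E') (ι := ι') (π := π') ?_ ?_ ?_
  · rintro (- | i)
    · exact (isSES_subtype_mkQ N).iso_left e
    · exact h i
  · rintro (- | i)
    · exact (IsProjective.iff_projective (R := R) (Fin n → R)).1 inferInstance
    · exact hE i
  · rintro (- | i)
    · exact inferInstanceAs (Module.Finite R (Fin n → R))
    · exact hE' i

/-- Coherence makes R^n/N of type FP_∞, so Ext¹(R^n/N, A) = 0 and a map N → A extends to R^n. -/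
theorem IsAbsolutelyClean.isPureSubmodule_range (hR : IsLeftCoherent R) {A E : Type u}
    [AddCommGroup A] [Module R A] [AddCommGroup E] [Module R E]
    (hA : IsAbsolutelyClean (ModuleCat.of R A)) {i : A →ₗ[R] E} (hi : Function.Injective i) :
    IsPureSubmodule (LinearMap.range i) := by
  intro n N hN x hx
  let φ : N →ₗ[R] A := (LinearEquiv.ofInjective i hi).symm.toLinearMap ∘ₗ
    (x ∘ₗ N.subtype).codRestrict (LinearMap.range i) fun v => hx v v.2
  have hφ : ∀ v, i (φ v) = x v := fun v =>
    congrArg Subtype.val ((LinearEquiv.ofInjective i hi).apply_symm_apply _)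
  obtain ⟨ψ, hψ⟩ := (isSES_subtype_mkQ N).exists_extend_of_ext_one
    (hA _ (isTypeFPInfty_quotient hR hN)) (ModuleCat.ofHom φ)
  refine ⟨i ∘ₗ ψ.hom, fun v => ⟨_, rfl⟩, fun v hv => ?_⟩
  have := LinearMap.congr_fun (congrArg ModuleCat.Hom.hom hψ) ⟨v, hv⟩
  exact (congrArg i this).trans (hφ ⟨v, hv⟩)

end AbsolutelyClean

/-! ### Level modules over right coherent rings -/

section Level

variable {R : Type u} [Ring R]

theorem exists_balancedMap_eq_of_isZero_tor {E Z : ℕ → ModuleCat.{u} Rᵐᵒᵖ}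
    {ι : ∀ i, Z (i + 1) ⟶ E i} {π : ∀ i, E i ⟶ Z i} (h : ∀ i, IsSES (ι i) (π i))
    (hE : ∀ i, Projective (E i)) {L : ModuleCat.{u} R} (hT : IsZero (Tor R 1 (Z 0) L))
    (t : BalancedTensor R (E 1) L) (ht : balancedMap R L (π 1 ≫ ι 0).hom t = 0) :
    ∃ w : BalancedTensor R (E 2) L, balancedMap R L (π 2 ≫ ι 1).hom w = t := by
  let F := tensorFunctor R L
  let C := (F.mapHomologicalComplex (ComplexShape.down ℕ)).obj (spliceChain h)
  have h1 : IsZero (C.homology 1) :=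
    hT.of_iso ((spliceResolution h hE).isoLeftDerivedObj F 1).symm
  have h2 : C.ExactAt 1 := (C.exactAt_iff_isZero_homology 1).2 h1
  have h3 := (C.exactAt_iff' 2 1 0 (ComplexShape.prev_eq' _ rfl) (ComplexShape.next_eq' _ rfl)).1 h2
  have hd : ∀ i, C.d (i + 1) i = F.map (π (i + 1) ≫ ι i) := fun i =>
    congrArg F.map (spliceChain_d h i)
  obtain ⟨w, hw⟩ := (ShortComplex.ab_exact_iff _).1 h3 t
    ((congrArg (fun f => (ConcreteCategory.hom f) t) (hd 0)).trans ht)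
  exact ⟨w, (congrArg (fun f => (ConcreteCategory.hom f) w) (hd 1)).symm.trans hw⟩

theorem balancedTensor_smul (M L : Type u) [AddCommGroup M] [Module Rᵐᵒᵖ M] [AddCommGroup L]
    [Module R L] (m : M) (r : R) (l : L) :
    (QuotientAddGroup.mk ((MulOpposite.op r • m) ⊗ₜ[ℤ] l) : BalancedTensor R M L) =
      QuotientAddGroup.mk (m ⊗ₜ[ℤ] (r • l)) := by
  exact QuotientAddGroup.eq_iff_sub_mem.2 (AddSubgroup.subset_closure ⟨m, r, l, rfl⟩)

/-- The map `R^n ⊗_R L → L`, `x ⊗ l ↦ x_j l`. -/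
noncomputable def evalTensor (L : Type u) [AddCommGroup L] [Module R L] {n : ℕ} (j : Fin n) :
    BalancedTensor R (Fin n → R) L →+ L :=
  QuotientAddGroup.lift _
    (TensorProduct.liftAddHom (M := Fin n → R) (N := L) (R := ℤ)
      ((((smulAddHom R L)).comp (Pi.evalAddMonoidHom (fun _ : Fin n => R) j)))
      (fun z x l => (smul_assoc z (x j) l).trans (smul_comm z (x j) l))) (by
    refine (AddSubgroup.closure_le _).2 ?_
    rintro _ ⟨m, r, l, rfl⟩
    rw [SetLike.mem_coe, AddMonoidHom.mem_ker, map_sub, sub_eq_zero]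
    exact mul_smul (m j) r l)

theorem evalTensor_mk (L : Type u) [AddCommGroup L] [Module R L] {n : ℕ} (j : Fin n)
    (x : Fin n → R) (l : L) : evalTensor L j (QuotientAddGroup.mk (x ⊗ₜ[ℤ] l)) = x j • l := rfl

/-- The matrix `(r i j)`, as a homomorphism of free right modules. -/
def rightMulVec {m n : ℕ} (r : Fin m → Fin n → R) : (Fin n → R) →ₗ[Rᵐᵒᵖ] (Fin m → R) where
  toFun x i := ∑ j, r i j * x j
  map_add' x y := by ext i; simp [mul_add, Finset.sum_add_distrib]
  map_smul' c x := by ext i; simp [Finset.sum_mul, mul_assoc]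

def opEquiv (R : Type u) [Ring R] : R ≃ₗ[Rᵐᵒᵖ] Rᵐᵒᵖ where
  toFun := MulOpposite.op
  invFun := MulOpposite.unop
  map_add' _ _ := rfl
  map_smul' _ _ := rfl
  left_inv _ := rfl
  right_inv _ := rfl

theorem projective_pi (n : ℕ) : Projective (ModuleCat.of Rᵐᵒᵖ (Fin n → R)) := by
  have : Module.Projective Rᵐᵒᵖ (Fin n → R) :=
    .of_equiv (LinearEquiv.piCongrRight fun _ : Fin n => (opEquiv R).symm)
  exact (IsProjective.iff_projective (R := Rᵐᵒᵖ) (Fin n → R)).1 this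

theorem finite_pi (n : ℕ) : Module.Finite Rᵐᵒᵖ (Fin n → R) := by
  have : Module.Finite Rᵐᵒᵖ R := .equiv (opEquiv R).symm
  infer_instance

/-- Coherence prolongs ρ to a resolution of its cokernel by finitely generated projectives.
Vanishing of Tor_1 is exactness after tensoring at R^n, with a P that does not depend on L. -/
theorem exists_exact_balancedMap (hR : IsRightCoherent R) {m n : ℕ}
    (ρ : (Fin n → R) →ₗ[Rᵐᵒᵖ] (Fin m → R)) :
    ∃ (P : ModuleCat.{u} Rᵐᵒᵖ) (f : P →ₗ[Rᵐᵒᵖ] (Fin n → R)), (∀ x, ρ (f x) = 0) ∧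
      ∀ L : ModuleCat.{u} R, IsLevel L → ∀ t, balancedMap R L ρ t = 0 →
        ∃ w, balancedMap R L f w = t := by
  have hm := finite_pi (R := R) m
  have hn := finite_pi (R := R) n
  have h1 : Module.FinitePresentation Rᵐᵒᵖ (LinearMap.range ρ) :=
    finitePresentation_of_injective_pi hR (LinearMap.range ρ).subtype Subtype.val_injective
  have h2 : Module.Finite Rᵐᵒᵖ (LinearMap.ker ρ.rangeRestrict) :=
    Module.Finite.iff_fg.2 (Module.FinitePresentation.fg_ker _ ρ.surjective_rangeRestrict)
  obtain ⟨E, Z, ι, π, ⟨e⟩, h, hE, hE'⟩ := exists_finite_projective_sequence hR (opEquiv R)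
    (ModuleCat.of Rᵐᵒᵖ (LinearMap.ker ρ.rangeRestrict))
    (finitePresentation_of_injective_pi hR (LinearMap.ker ρ.rangeRestrict).subtype
      Subtype.val_injective)
  let E' : ℕ → ModuleCat.{u} Rᵐᵒᵖ := fun
    | 0 => ModuleCat.of Rᵐᵒᵖ (Fin m → R)
    | 1 => ModuleCat.of Rᵐᵒᵖ (Fin n → R)
    | i + 2 => E i
  let Z' : ℕ → ModuleCat.{u} Rᵐᵒᵖ := fun
    | 0 => ModuleCat.of Rᵐᵒᵖ ((Fin m → R) ⧸ LinearMap.range ρ)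
    | 1 => ModuleCat.of Rᵐᵒᵖ (LinearMap.range ρ)
    | i + 2 => Z i
  let ι' : ∀ i, Z' (i + 1) ⟶ E' i := fun
    | 0 => ModuleCat.ofHom (LinearMap.range ρ).subtype
    | 1 => e.hom ≫ ModuleCat.ofHom (LinearMap.ker ρ.rangeRestrict).subtype
    | i + 2 => ι i
  let π' : ∀ i, E' i ⟶ Z' i := fun
    | 0 => ModuleCat.ofHom (LinearMap.range ρ).mkQ
    | 1 => ModuleCat.ofHom ρ.rangeRestrict
    | i + 2 => π i
  have hs : ∀ i, IsSES (ι' i) (π' i) := by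
    rintro (- | - | i)
    · exact isSES_subtype_mkQ _
    · exact (isSES_ker ρ.surjective_rangeRestrict).iso_left e
    · exact h i
  have hp : ∀ i, Projective (E' i) := by
    rintro (- | - | i)
    · exact projective_pi m
    · exact projective_pi n
    · exact hE i
  have hf : ∀ i, Module.Finite Rᵐᵒᵖ (E' i) := by
    rintro (- | - | i)
    · exact hm
    · exact hn
    · exact hE' i
  refine ⟨E' 2, (π' 2 ≫ ι' 1).hom, fun x => ?_, fun L hL => exists_balancedMap_eq_of_isZero_tor hs
    hp (hL _ (isTypeFPInfty_of_sequence hs hp hf))⟩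
  exact congrArg Subtype.val
    (LinearMap.congr_fun (congrArg ModuleCat.Hom.hom (hs 1).comp_eq_zero) (π' 2 x))

/-- The equational criterion for level modules over a right coherent ring. -/
theorem IsLevel.exists_sum_eq (hR : IsRightCoherent R) {L : ModuleCat.{u} R} (hL : IsLevel L)
    {m n : ℕ} (r : Fin m → Fin n → R) (l : Fin n → L) (hl : ∀ i, ∑ j, r i j • l j = 0) :
    ∃ (k : ℕ) (w : Fin k → Fin n → R) (y : Fin k → L),
      (∀ a i, ∑ j, r i j * w a j = 0) ∧ ∀ j, l j = ∑ a, w a j • y a := by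
  obtain ⟨P, f, hf, key⟩ := exists_exact_balancedMap hR (rightMulVec r)
  -- The relations on l say exactly that t = ∑ e_j ⊗ l_j dies in R^m ⊗ L. A preimage ∑ p_a ⊗ y_a
  -- gives w_a = f (p_a), and the j-th coordinate recovers l_j.
  let t : BalancedTensor R (Fin n → R) L := ∑ j, QuotientAddGroup.mk (Pi.single j 1 ⊗ₜ[ℤ] l j)
  have hcol : ∀ j, rightMulVec r (Pi.single j 1) =
      ∑ i, MulOpposite.op (r i j) • (Pi.single i 1 : Fin m → R) := fun j => by
    ext i
    simp [rightMulVec, Pi.single_apply, Finset.sum_apply]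
  have ht : balancedMap R L (rightMulVec r) t = 0 := by
    have h1 : ∀ j, balancedMap R L (rightMulVec r)
        (QuotientAddGroup.mk (Pi.single j 1 ⊗ₜ[ℤ] l j)) =
          ∑ i, QuotientAddGroup.mk ((Pi.single i 1 : Fin m → R) ⊗ₜ[ℤ] (r i j • l j)) := fun j => by
      change QuotientAddGroup.mk (rightMulVec r (Pi.single j 1) ⊗ₜ[ℤ] l j) = _
      rw [hcol, TensorProduct.sum_tmul]
      exact (map_sum (QuotientAddGroup.mk' (balancedRelations R (Fin m → R) L)) _ _).trans
        (Finset.sum_congr rfl fun i _ => balancedTensor_smul _ _ _ _ _)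
    rw [map_sum, Finset.sum_congr rfl fun j _ => h1 j, Finset.sum_comm]
    refine Finset.sum_eq_zero fun i _ => ?_
    refine (map_sum (QuotientAddGroup.mk' (balancedRelations R (Fin m → R) L)) _ _).symm.trans ?_
    rw [← TensorProduct.tmul_sum, hl, TensorProduct.tmul_zero, map_zero]
  obtain ⟨w, hw⟩ := key L hL t ht
  obtain ⟨w, rfl⟩ := QuotientAddGroup.mk_surjective w
  obtain ⟨k, p, y, rfl⟩ := TensorProduct.exists_sum_tmul_eq w
  refine ⟨k, fun a => f (p a), y, fun a i => congrFun (hf (p a)) i, fun j => ?_⟩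
  have h2 := congrArg (evalTensor L j) hw
  have h3 : evalTensor L j t = l j := by
    rw [map_sum, Finset.sum_eq_single j]
    · rw [evalTensor_mk, Pi.single_eq_same, one_smul]
    · intro b _ hb
      rw [evalTensor_mk, Pi.single_eq_of_ne hb.symm, zero_smul]
    · exact fun h => absurd (Finset.mem_univ j) h
  rw [h3] at h2
  refine h2.symm.trans ?_
  have h4 : (QuotientAddGroup.mk (∑ a, p a ⊗ₜ[ℤ] y a) : BalancedTensor R P L) =
      ∑ a, QuotientAddGroup.mk (p a ⊗ₜ[ℤ] y a) :=
    map_sum (QuotientAddGroup.mk' (balancedRelations R P L)) _ _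
  rw [h4, map_sum, map_sum]
  rfl

/-- Over a right coherent ring, the kernel of a homomorphism onto a level module is pure. -/
theorem IsLevel.isPureSubmodule_ker (hR : IsRightCoherent R) {L : ModuleCat.{u} R} (hL : IsLevel L)
    {F : Type u} [AddCommGroup F] [Module R F] {π : F →ₗ[R] L} (hπ : Function.Surjective π) :
    IsPureSubmodule (LinearMap.ker π) := by
  intro n N hN x hx
  obtain ⟨m, r, rfl⟩ := Submodule.fg_iff_exists_fin_generating_family.1 hN
  have hlc : ∀ (v : Fin n → R), ∑ j, v j • x (Pi.single j 1) = x v := fun v => by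
    conv_rhs => rw [← Finset.univ_sum_single v, map_sum]
    refine Finset.sum_congr rfl fun j _ => ?_
    rw [← map_smul, ← Pi.single_smul, smul_eq_mul, mul_one]
  -- The images in L of the values x(e_j) satisfy the relations r. Lifting their expression through
  -- the y_a to F gives s with π s = π x and s = 0 on N, so x - s is the required solution.
  obtain ⟨k, w, y, hw, hy⟩ := hL.exists_sum_eq hR r (fun j => π (x (Pi.single j 1))) fun i => by
    have := LinearMap.mem_ker.1 (hx (r i) (Submodule.subset_span ⟨i, rfl⟩))
    rw [← hlc, map_sum] at this
    simpa using this
  choose z hz using fun a => hπ (y a)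
  let s : (Fin n → R) →ₗ[R] F :=
    Fintype.linearCombination R fun j => ∑ a, w a j • z a
  have hs : ∀ v, s v = ∑ j, v j • ∑ a, w a j • z a := fun v => rfl
  refine ⟨x - s, fun v => ?_, fun v hv => ?_⟩
  · rw [LinearMap.mem_ker, LinearMap.sub_apply, map_sub, ← hlc, hs, map_sum, map_sum, sub_eq_zero]
    refine Finset.sum_congr rfl fun j _ => ?_
    rw [map_smul, map_smul, hy, map_sum]
    simp [hz]
  · suffices h : s v = 0 by rw [LinearMap.sub_apply, h, sub_zero]
    refine LinearMap.mem_ker.1 ((Submodule.span_le (p := LinearMap.ker s)).2 ?_ hv)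
    rintro _ ⟨i, rfl⟩
    change s (r i) = 0
    simp_rw [hs, Finset.smul_sum, smul_smul]
    rw [Finset.sum_comm]
    refine Finset.sum_eq_zero fun a _ => ?_
    rw [← Finset.sum_smul, hw, zero_smul]

end Level
-- Consequences of finite global Gorenstein dimension
section Dimension

variable {R : Type u} [Ring R]

theorem IsGProjectiveRel.of_iso {𝓛 : ModuleCat.{u} R → Prop} {M N : ModuleCat.{u} R} (e : M ≅ N) :
    IsGProjectiveRel 𝓛 M → IsGProjectiveRel 𝓛 N := fun ⟨P, h1, h2, ⟨i⟩, h3⟩ =>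
  ⟨P, h1, h2, ⟨e.symm ≪≫ i⟩, h3⟩

theorem IsGInjectiveRel.of_iso {𝓐 : ModuleCat.{u} R → Prop} {M N : ModuleCat.{u} R} (e : M ≅ N) :
    IsGInjectiveRel 𝓐 M → IsGInjectiveRel 𝓐 N := fun ⟨I, h1, h2, ⟨i⟩, h3⟩ =>
  ⟨I, h1, h2, ⟨e.symm ≪≫ i⟩, h3⟩

theorem exists_hasLeftResolution_of_leftDim_le {𝓧 : ModuleCat.{u} R → Prop} {M : ModuleCat.{u} R}
    {N : ℕ} (h : leftDim 𝓧 M ≤ N) : ∃ m ≤ N, HasLeftResolution 𝓧 m M := by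
  have h1 : leftDim 𝓧 M < (N + 1 : ℕ) := h.trans_lt (by exact_mod_cast Nat.lt_succ_self N)
  simp only [leftDim, iInf_lt_iff] at h1
  obtain ⟨m, hm, h2⟩ := h1
  exact ⟨m, Nat.lt_succ_iff.1 (by exact_mod_cast h2), hm⟩

theorem HasLeftResolution.mono {𝓧 𝓨 : ModuleCat.{u} R → Prop} (h : ∀ M, 𝓧 M → 𝓨 M) {n : ℕ}
    {M : ModuleCat.{u} R} : HasLeftResolution 𝓧 n M → HasLeftResolution 𝓨 n M :=
  fun ⟨E, h1, h2, h3, h4⟩ => ⟨E, h1, h2, fun i hi => h _ (h3 i hi), h4⟩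

theorem leftDim_anti {𝓧 𝓨 : ModuleCat.{u} R → Prop} (h : ∀ M, 𝓧 M → 𝓨 M)
    (M : ModuleCat.{u} R) : leftDim 𝓨 M ≤ leftDim 𝓧 M :=
  le_iInf₂ fun n hn => iInf₂_le n (hn.mono h)

theorem exists_nat_of_globalGorensteinDim_lt_top (hR : globalGorensteinDim R < ⊤) :
    ∃ n : ℕ, ∀ M : ModuleCat.{u} R, ∃ m ≤ n, IsLeftResolved IsCoresolvable m M := by
  obtain ⟨n, hn⟩ := ENat.ne_top_iff_exists.1 hR.ne
  refine ⟨n, fun M => ?_⟩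
  obtain ⟨m, hm, h⟩ := exists_hasLeftResolution_of_leftDim_le
    ((le_iSup gorensteinProjectiveDim M).trans hn.ge)
  exact ⟨m, hm, (h.isLeftResolved IsGProjectiveRel.of_iso).mono fun _ =>
    IsGorensteinProjective.isCoresolvable⟩

theorem hasInjectiveDimensionLE_of_projective {n : ℕ}
    (hn : ∀ M : ModuleCat.{u} R, ∃ m ≤ n, IsLeftResolved IsCoresolvable m M) {P : ModuleCat.{u} R}
    (hP : Projective P) : HasInjectiveDimensionLE P n := by
  refine hasInjectiveDimensionLT_of_enoughProjectives P (n + 1) fun M => ?_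
  obtain ⟨m, hm, h⟩ := hn M
  obtain ⟨i, rfl⟩ := Nat.exists_eq_add_of_le' hm
  exact h.ext_eq_zero hP i

theorem hasProjectiveDimensionLE_of_injective {n : ℕ}
    (hn : ∀ M : ModuleCat.{u} R, ∃ m ≤ n, IsLeftResolved IsCoresolvable m M) {E : ModuleCat.{u} R}
    [Injective E] : HasProjectiveDimensionLE E n := by
  obtain ⟨m, hm, h⟩ := hn E
  have := h.hasProjectiveDimensionLE_of_injective
  exact hasProjectiveDimensionLT_of_ge E (m + 1) (n + 1) (by lia)

/-- In 0 → K → P → M → 0, injective dimension at most n passes from K and P to M, so the bound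
survives the induction. -/
theorem hasInjectiveDimensionLE_of_hasProjectiveDimensionLT {n m : ℕ}
    (hP : ∀ P : ModuleCat.{u} R, Projective P → HasInjectiveDimensionLE P n)
    {M : ModuleCat.{u} R} (hM : HasProjectiveDimensionLT M m) : HasInjectiveDimensionLE M n := by
  induction m generalizing M with
  | zero =>
    exact hP M (((hasProjectiveDimensionLT_zero_iff_isZero M).1 hM).projective)
  | succ m ih =>
    obtain ⟨K, P, f, g, hPr, h⟩ := exists_projective_isSES M
    have hP' := hP P hPr
    obtain _ | m := m
    · exact hP M (projective_iff_hasProjectiveDimensionLT_one.2 hM)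
    have : HasProjectiveDimensionLT P (m + 1) := hasProjectiveDimensionLT_of_ge P 1 _ (by lia)
    have hK := ih (h.shortExact.hasProjectiveDimensionLT_X₁ (m + 1) this hM)
    exact h.shortExact.hasInjectiveDimensionLT_X₃ (n + 1) hP'
      (hasInjectiveDimensionLT_of_ge K (n + 1) _ (by lia))

theorem IsAbsolutelyClean.hasProjectiveDimensionLE {n : ℕ}
    (hn : ∀ M : ModuleCat.{u} R, ∃ m ≤ n, IsLeftResolved IsCoresolvable m M)
    (hR : IsLeftCoherent R) {A : ModuleCat.{u} R} (hA : IsAbsolutelyClean A) :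
    HasProjectiveDimensionLE A n := by
  obtain ⟨E, C, f, g, hE, h⟩ := exists_injective_isSES A
  exact hasProjectiveDimensionLE_of_pure
    (fun _ _ => hasProjectiveDimensionLE_of_finite
      fun _ => hasInjectiveDimensionLE_of_projective hn)
    (i := f.hom) h.inj (hA.isPureSubmodule_range hR h.inj)
    (hasProjectiveDimensionLE_of_injective hn (E := E))

/-- The kernel of a free cover is pure in a free module, so it has dimension at most n. The
resulting bound n + 1 is enough, since only finiteness is used later. -/
theorem IsLevel.hasProjectiveDimensionLT {n : ℕ}
    (hn : ∀ M : ModuleCat.{u} R, ∃ m ≤ n, IsLeftResolved IsCoresolvable m M)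
    (hR : IsRightCoherent R) {L : ModuleCat.{u} R} (hL : IsLevel L) :
    HasProjectiveDimensionLT L (n + 2) := by
  obtain ⟨π, hπ⟩ := exists_finsupp_surjective (R := R) L
  have h := hL.isPureSubmodule_ker hR hπ
  rw [← (LinearMap.ker π).range_subtype] at h
  exact (isSES_ker hπ).shortExact.hasProjectiveDimensionLT_X₃ (n + 1)
    (hasProjectiveDimensionLE_of_pure
      (fun _ _ => hasProjectiveDimensionLE_of_finite
        fun _ => hasInjectiveDimensionLE_of_projective hn)
      (LinearMap.ker π).injective_subtype h (hasProjectiveDimensionLE_of_module_projective 0))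
    (hasProjectiveDimensionLE_of_module_projective _)

/-- The same complex works: level modules have finite injective dimension, so Hom into them
preserves exactness of any acyclic complex of projectives. -/
theorem IsGorensteinProjective.isGorensteinACProjective {n : ℕ}
    (hn : ∀ M : ModuleCat.{u} R, ∃ m ≤ n, IsLeftResolved IsCoresolvable m M)
    (hR : IsRightCoherent R) {G : ModuleCat.{u} R} (hG : IsGorensteinProjective G) :
    IsGorensteinACProjective G := by
  obtain ⟨P, h1, h2, h3, -⟩ := hG
  exact ⟨P, h1, h2, h3, fun L hL => homExactInto_of_hasInjectiveDimensionLT h2 h1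
    (hasInjectiveDimensionLE_of_hasProjectiveDimensionLT
      (fun _ => hasInjectiveDimensionLE_of_projective hn) (hL.hasProjectiveDimensionLT hn hR))⟩

theorem isGorensteinACInjective_of_isCosyzygy {n : ℕ}
    (hn : ∀ M : ModuleCat.{u} R, ∃ m ≤ n, IsLeftResolved IsCoresolvable m M)
    (hR : IsLeftCoherent R) {X : ModuleCat.{u} R} (hX : Injective X ∨ ∃ M, IsCosyzygy n M X) :
    IsGorensteinACInjective X := by
  obtain ⟨I, h1, h2, h3⟩ :=
    exists_injective_complex (fun _ => hasInjectiveDimensionLE_of_projective hn) hX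
  exact ⟨I, h1, h2, h3, fun A hA =>
    homExactFrom_of_hasProjectiveDimensionLT h2 h1 (hA.hasProjectiveDimensionLE hn hR)⟩

end Dimension

end GorAC

theorem mainTheorem3 {R : Type u} [Ring R] (hR : GorAC.globalGorensteinDim R < ⊤) :
    (GorAC.IsLeftCoherent R → GorAC.globalGorensteinACInjectiveDim R < ⊤) ∧
      (GorAC.IsRightCoherent R → GorAC.globalGorensteinACProjectiveDim R < ⊤) := by
  obtain ⟨n, hn⟩ := GorAC.exists_nat_of_globalGorensteinDim_lt_top hR
  refine ⟨fun hl => ?_, fun hr => ?_⟩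
  -- The coresolution consists of n injectives followed by the n-th cosyzygy, all of them Gorenstein
  -- AC-injective.
  · refine (iSup_le fun M => ?_ : _ ≤ (n : ℕ∞)).trans_lt (ENat.natCast_lt_top n)
    obtain ⟨X, hX⟩ := GorAC.exists_isCosyzygy n M
    exact iInf₂_le n (GorAC.hasRightResolution_of_isCosyzygy GorAC.IsGInjectiveRel.of_iso
      (fun I hI => GorAC.isGorensteinACInjective_of_isCosyzygy hn hl (.inl hI)) hX
      (GorAC.isGorensteinACInjective_of_isCosyzygy hn hl (.inr ⟨M, hX⟩)))
  · exact (iSup_mono fun M => GorAC.leftDim_anti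
      (fun _ hG => hG.isGorensteinACProjective hn hr) M).trans_lt hR
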